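/- Let $\mathcal H$ be a right quaternionic Hilbert space, let $T$ be a bounded right $\mathbb H$-linear operator on $\mathcal H$ (not necessarily normal), and for $q\in\mathbb H$ put $\Delta_q(T)=T^2-2\,\mathrm{re}(q)\,T+|q|^2I$. The spherical spectrum of $T$ is $\sigma_S(T)=\{q\in\mathbb H:\Delta_q(T)\text{ is not invertible in }\mathcal B(\mathcal H)\}$. Let $\mathbb S=\{m\in\mathbb H:\overline m=-m,\ |m|=1\}$, and for $m\in\mathbb S$ identify $\mathbb C_m=\{\alpha+m\beta:\alpha,\beta\in\mathbb R\}$ with $\mathbb C$ by $\alpha+m\beta\leftrightarrow\alpha+i\beta$. A set $K\subseteq\mathbb H$ is axially symmetric if $K=\{\alpha+m\beta:\alpha,\beta\in\mathbb R,\ \alpha+i\beta\in S,\ m\in\mathbb S\}$ for some $S\subseteq\mathbb C$ invariant under complex conjugation. Suppose that $\sigma_S(T)=\sigma\cup\tau$, where $\sigma$ and $\tau$ are disjoint nonempty axially symmetric closed sets. Then $T$ is strongly reducible, that is, there is an idempotent $E\in\mathcal B(\mathcal H)$ with $E\ne0$, $E\ne I$ and $TE=ET$. More precisely, there is an idempotent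 $P\in\mathcal B(\mathcal H)$ with $P\neq 0$, $P\neq I$ and $TP=PT$ which is the Riesz projection belonging to $\sigma$, in the following sense. For $m\in\mathbb S$, say that a contour $\Gamma$ in $\mathbb C_m$ (a finite family of closed piecewise continuously differentiable curves) separates $\sigma$ from $\tau$ if it avoids $\sigma\cup\tau$ and has winding number $1$ about every point of $\sigma\cap\mathbb C_m$ and $0$ about every point of $\tau\cap\mathbb C_m$. Then for every $m\in\mathbb S$ such contours exist, and for every such $\Gamma$, every Hilbert basis $\mathcal N$ of $\mathcal H$ and every $x\in\mathcal H$, $$Px=\frac1{2\pi}\int_{\Gamma}ds_m\,S_R^{-1}(s,T)x,\qquad ds_m=-ds\,m,\qquad S_R^{-1}(s,T)=-(T-\overline sI)\Delta_s(T)^{-1},$$ where quaternions multiply vectors from the left by $q\cdot x=\sum_{z\in\mathcal N}z\,q\,\langle z,x\rangle$ (so that $(\overline sI)x=\overline s\cdot x$). -/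

import Mathlib

open scoped Quaternion ComplexConjugate
open MulOpposite

noncomputable section

/-- The structure of a quaternionic inner product on a right `ℍ`-module `H` (the right action of
`q` on `x` is `op q • x`), compatible with the norm of `H`, that is, `‖x‖ = √⟪x, x⟫`. The last
axiom contains positivity and definiteness, because `‖·‖` is a norm. -/
class QuaternionicInnerProductSpace (H : Type*) [NormedAddCommGroup H] [Module ℍ[ℝ]ᵐᵒᵖ H]
    extends Inner ℍ[ℝ] H where
  inner_add_right : ∀ x y z : H, inner x (y + z) = inner x y + inner x z
  inner_smul_right : ∀ (x y : H) (q : ℍ[ℝ]), inner x (op q • y) = inner x y * q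
  star_inner : ∀ x y : H, star (inner y x) = inner x y
  inner_self : ∀ x : H, inner x x = ((‖x‖ ^ 2 : ℝ) : ℍ[ℝ])

namespace Quat

/-- The sphere of imaginary units of the quaternions. -/
def imaginaryUnits : Set ℍ[ℝ] := {m | star m = -m ∧ ‖m‖ = 1}

/-- The identification `α + iβ ↦ α + mβ` of `ℂ` with the slice `ℂ_m`. -/
def slicePt (m : ℍ[ℝ]) (z : ℂ) : ℍ[ℝ] := (z.re : ℍ[ℝ]) + m * (z.im : ℍ[ℝ])

/-- The circularization `Ω_S` of a set `S` of complex numbers. -/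
def circularization (S : Set ℂ) : Set ℍ[ℝ] :=
  {q | ∃ z ∈ S, ∃ m ∈ imaginaryUnits, q = slicePt m z}

/-- Axially symmetric (circular) sets of quaternions. -/
def IsAxiallySymmetric (K : Set ℍ[ℝ]) : Prop :=
  ∃ S : Set ℂ, (∀ z ∈ S, conj z ∈ S) ∧ K = circularization S

/-- `T` is strongly reducible: it commutes with an idempotent bounded operator other than
`0` and `I`. -/
def IsStronglyReducible {H : Type*} [NormedAddCommGroup H] [Module ℍ[ℝ]ᵐᵒᵖ H]
    (T : H →L[ℍ[ℝ]ᵐᵒᵖ] H) : Prop :=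
  ∃ E : H →L[ℍ[ℝ]ᵐᵒᵖ] H, E * E = E ∧ E ≠ 0 ∧ E ≠ 1 ∧ T * E = E * T

section Operators

variable {H : Type*} [NormedAddCommGroup H] [NormedSpace ℝ H] [Module ℍ[ℝ]ᵐᵒᵖ H]
  [IsScalarTower ℝ ℍ[ℝ]ᵐᵒᵖ H]

/-- The operator `Δ_q(T) = T² - 2 re(q) T + |q|² I`. -/
def Delta (q : ℍ[ℝ]) (T : H →L[ℍ[ℝ]ᵐᵒᵖ] H) : H →L[ℍ[ℝ]ᵐᵒᵖ] H :=
  T ^ 2 - (2 * q.re) • T + (‖q‖ ^ 2) • (1 : H →L[ℍ[ℝ]ᵐᵒᵖ] H)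

/-- The spherical spectrum. -/
def sphericalSpectrum (T : H →L[ℍ[ℝ]ᵐᵒᵖ] H) : Set ℍ[ℝ] := {q | ¬ IsUnit (Delta q T)}

variable [QuaternionicInnerProductSpace H]

/-- `N` is a Hilbert basis of `H`. -/
def IsHilbertBasis (N : Set H) : Prop :=
  (∀ z ∈ N, inner ℍ[ℝ] z z = 1) ∧ (∀ z ∈ N, ∀ w ∈ N, z ≠ w → inner ℍ[ℝ] z w = 0) ∧
  ∀ x y : H, (Summable fun z : N => ‖inner ℍ[ℝ] x (z : H) * inner ℍ[ℝ] (z : H) y‖) ∧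
    HasSum (fun z : N => inner ℍ[ℝ] x (z : H) * inner ℍ[ℝ] (z : H) y) (inner ℍ[ℝ] x y)

/-- The left multiplication `x ↦ q · x = ∑ z q ⟪z, x⟫` (sum over `z ∈ N`) by a quaternion `q`
that is induced by a Hilbert basis `N`. The operator `q · A` is `x ↦ q · (A x)`. -/
def leftMul (N : Set H) (q : ℍ[ℝ]) (x : H) : H :=
  ∑' z : N, op (q * inner ℍ[ℝ] (z : H) x) • (z : H)

/-- The right spherical resolvent operator `S_R⁻¹(s, T) = -(T - s̄ I) Δ_s(T)⁻¹`. -/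
def rightResolvent (N : Set H) (s : ℍ[ℝ]) (T : H →L[ℍ[ℝ]ᵐᵒᵖ] H) (x : H) : H :=
  -(T (Ring.inverse (Delta s T) x) - leftMul N (star s) (Ring.inverse (Delta s T) x))

end Operators

/-- A contour in the plane: a finite family of closed piecewise continuously differentiable
curves. It is given by its `C¹` arcs, each parametrized by `[0, 1]`; the arc `k` is followed by
the arc `next k`, so that the closed curves are the cycles of the permutation `next`. -/
structure Contour where
  card : ℕ
  arc : Fin card → ℝ → ℂ
  next : Equiv.Perm (Fin card)
  contDiffOn : ∀ k, ContDiffOn ℝ 1 (arc k) (Set.Icc 0 1)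
  closes : ∀ k, arc k 1 = arc (next k) 0

/-- The winding number `(2πi)⁻¹ ∫_Γ dz / (z - w)`. -/
def Contour.wind (Γ : Contour) (w : ℂ) : ℂ :=
  (2 * Real.pi * Complex.I)⁻¹ *
    ∑ k, ∫ t in (0 : ℝ)..1, deriv (Γ.arc k) t / (Γ.arc k t - w)

/-- The contour `Γ`, placed in the slice `ℂ_m`, avoids `σ ∪ τ`, winds once (in the positive
direction) around each point of `σ ∩ ℂ_m`, and does not wind around the points of `τ ∩ ℂ_m`.
The positively oriented boundary of `U ∩ ℂ_m`, where `U ⊇ σ` is a bounded axially symmetric open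
set with closure disjoint from `τ`, is of this kind if it consists of finitely many piecewise
`C¹` Jordan curves. -/
def Contour.Separates (Γ : Contour) (m : ℍ[ℝ]) (σ τ : Set ℍ[ℝ]) : Prop :=
  (∀ k, ∀ t ∈ Set.Icc (0 : ℝ) 1, slicePt m (Γ.arc k t) ∉ σ ∪ τ) ∧
  (∀ z, slicePt m z ∈ σ → Γ.wind z = 1) ∧ (∀ z, slicePt m z ∈ τ → Γ.wind z = 0)

section Riesz

variable {H : Type*} [NormedAddCommGroup H] [NormedSpace ℝ H] [Module ℍ[ℝ]ᵐᵒᵖ H]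
  [IsScalarTower ℝ ℍ[ℝ]ᵐᵒᵖ H] [QuaternionicInnerProductSpace H]

/-- The value at `x` of the Riesz integral `(2π)⁻¹ ∫_Γ ds_m S_R⁻¹(s, T)`, where `Γ` is placed in
the slice `ℂ_m` and `ds_m = -ds m`. -/
def rieszIntegral (T : H →L[ℍ[ℝ]ᵐᵒᵖ] H) (m : ℍ[ℝ]) (N : Set H) (Γ : Contour) (x : H) : H :=
  (2 * Real.pi)⁻¹ • ∑ k, ∫ t in (0 : ℝ)..1,
    leftMul N (-(slicePt m (deriv (Γ.arc k) t) * m)) (rightResolvent N (slicePt m (Γ.arc k t)) T x)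

/-- `P` is the Riesz projection of `T` for the part `σ` of the spherical spectrum `σ ∪ τ`: in
every slice there are contours that separate `σ` from `τ`, and `P` is the Riesz integral over
each of them, whatever the slice and the Hilbert basis that induces the left multiplication. -/
def IsRieszProjection (T : H →L[ℍ[ℝ]ᵐᵒᵖ] H) (σ τ : Set ℍ[ℝ]) (P : H →L[ℍ[ℝ]ᵐᵒᵖ] H) : Prop :=
  ∀ m ∈ imaginaryUnits, (∃ Γ : Contour, Γ.Separates m σ τ) ∧
    ∀ N : Set H, IsHilbertBasis N → ∀ Γ : Contour, Γ.Separates m σ τ →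
      ∀ x, P x = rieszIntegral T m N Γ x

end Riesz

end Quat

end

/-! Right multiplication by the quaternions `α + iβ` makes `H` a complex Banach space (`SliceSpace
H`) on which `T` is complex linear. If `s` is the point of `ℂ_m` corresponding to `z`, then `Δ_s(T)
= (z - T)(z̄ - T)` whatever `m` is, and this identifies the spherical spectrum in every slice with
the complex spectrum of `T` (`toSlice_Delta`, `mem_spectrum_toSlice`). The sets `σ` and `τ` thus
become disjoint closed conjugation-invariant parts `S₁`, `S₂` of an ordinary spectrum. A square grid
yields a contour separating them (`exists_contour`), and the classical Riesz integral gives a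
complex linear operator `P`.

Independence of the contour does not rest on a homology form of Cauchy's theorem. The Cauchy
transform of the resolvent shows that `(z - T)⁻¹(1 - P)` continues analytically to `S₁` and `(z -
T)⁻¹P` to `S₂` (`Contour.isSpectralSplitting_riesz`). By Liouville's theorem at most one `P` has
this property (`IsSpectralSplitting.unique`); the same argument gives `P² = P`. Conjugation by `j`
is a conjugate-linear ring endomorphism that fixes `T`, so it carries `P` to another splitting
operator, hence to `P` itself. Being complex linear and commuting with `j`, `P` is `ℍ`-linear.

It remains to recognize the quaternionic integral. Separating the parts with and without the
imaginary unit, the complex integral is `-A - Bi` and the quaternionic one is `mA - B`, where `A`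
and `B` are the same `ℍ`-homogeneous maps, `i` acts from the right and `m` from the left
(`toReal_integral_resolvent`, `integrand_eq`). The complex integral equals `2πPi`, and comparison at
`x` and `xj` forces `A = 0`. So `2πP = -B`, and neither the slice nor the Hilbert basis matters. -/

open Filter Topology Set MeasureTheory

namespace Quat

/-! ### Contour integrals, Cauchy transforms and winding numbers. -/

namespace Contour

variable {E : Type*} [NormedAddCommGroup E] [NormedSpace ℂ E]

/-- The contour integral of `f` along `Γ`. -/
noncomputable def integral (Γ : Contour) (f : ℂ → E) : E :=
  ∑ k, ∫ t in (0 : ℝ)..1, deriv (Γ.arc k) t • f (Γ.arc k t)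

/-- The set of points through which the contour passes. -/
def support (Γ : Contour) : Set ℂ := ⋃ k, Γ.arc k '' Icc 0 1

variable (Γ : Contour)

lemma arc_mem_support (k : Fin Γ.card) {t : ℝ} (ht : t ∈ Icc (0 : ℝ) 1) :
    Γ.arc k t ∈ Γ.support :=
  mem_iUnion.2 ⟨k, t, ht, rfl⟩

lemma continuousOn_arc (k : Fin Γ.card) : ContinuousOn (Γ.arc k) (Icc 0 1) :=
  (Γ.contDiffOn k).continuousOn

lemma isCompact_support : IsCompact Γ.support :=
  isCompact_iUnion fun k => isCompact_Icc.image_of_continuousOn (Γ.continuousOn_arc k)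

lemma isClosed_support : IsClosed Γ.support := Γ.isCompact_support.isClosed

lemma hasDerivAt_arc (k : Fin Γ.card) {t : ℝ} (ht : t ∈ Ioo (0 : ℝ) 1) :
    HasDerivAt (Γ.arc k) (deriv (Γ.arc k) t) t :=
  (((Γ.contDiffOn k).differentiableOn one_ne_zero).differentiableAt
    (Icc_mem_nhds ht.1 ht.2)).hasDerivAt

/-- The two-sided `deriv` may be meaningless at the endpoints of an arc, so it is replaced almost
everywhere by `derivWithin`, which is continuous on the closed interval. The bilinear map `L` serves
both `dz` and its real and imaginary parts as weights. -/
lemma intervalIntegrable_of_continuousOn_mul {F : Type*} [NormedAddCommGroup F] [NormedSpace ℝ F]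
    (k : Fin Γ.card) {g h : ℝ → F} (L : ℂ →L[ℝ] F →L[ℝ] F)
    (hg : ContinuousOn g (Icc 0 1))
    (hh : ∀ t ∈ Icc (0 : ℝ) 1, h t = L (deriv (Γ.arc k) t) (g t)) :
    IntervalIntegrable h volume 0 1 := by
  have h1 : ContinuousOn (derivWithin (Γ.arc k) (Icc 0 1)) (Icc 0 1) :=
    (Γ.contDiffOn k).continuousOn_derivWithin (uniqueDiffOn_Icc zero_lt_one) le_rfl
  have h2 : ContinuousOn (fun t => L (derivWithin (Γ.arc k) (Icc 0 1) t) (g t)) (Icc 0 1) :=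
    (L.continuous.comp_continuousOn h1).clm_apply hg
  have h3 : IntervalIntegrable (fun t => L (derivWithin (Γ.arc k) (Icc 0 1) t) (g t))
      volume 0 1 := by
    apply ContinuousOn.intervalIntegrable
    rwa [uIcc_of_le zero_le_one]
  refine h3.congr_ae ?_
  rw [uIoc_of_le zero_le_one]
  have h4 : ∀ᵐ t : ℝ, t ≠ 1 := by simp [ae_iff, measure_singleton]
  filter_upwards [ae_restrict_mem measurableSet_Ioc, ae_restrict_of_ae h4] with t ht ht1
  have ht' : t ∈ Ioo (0 : ℝ) 1 := ⟨ht.1, lt_of_le_of_ne ht.2 ht1⟩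
  rw [hh t ⟨ht.1.le, ht.2⟩, derivWithin_of_mem_nhds (Icc_mem_nhds ht'.1 ht'.2)]

variable {Γ}

lemma intervalIntegrable (k : Fin Γ.card) {f : ℂ → E} (hf : ContinuousOn f Γ.support) :
    IntervalIntegrable (fun t => deriv (Γ.arc k) t • f (Γ.arc k t)) volume 0 1 :=
  Γ.intervalIntegrable_of_continuousOn_mul k (ContinuousLinearMap.lsmul ℝ ℂ)
    (hf.comp (Γ.continuousOn_arc k) fun _ ht => Γ.arc_mem_support k ht) fun _ _ => rfl

lemma integral_add {f g : ℂ → E} (hf : ContinuousOn f Γ.support)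
    (hg : ContinuousOn g Γ.support) :
    Γ.integral (fun z => f z + g z) = Γ.integral f + Γ.integral g := by
  simp only [integral, smul_add, ← Finset.sum_add_distrib]
  exact Finset.sum_congr rfl fun k _ =>
    intervalIntegral.integral_add (intervalIntegrable k hf) (intervalIntegrable k hg)

lemma integral_sub {f g : ℂ → E} (hf : ContinuousOn f Γ.support)
    (hg : ContinuousOn g Γ.support) :
    Γ.integral (fun z => f z - g z) = Γ.integral f - Γ.integral g := by
  simp only [integral, smul_sub, ← Finset.sum_sub_distrib]
  exact Finset.sum_congr rfl fun k _ =>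
    intervalIntegral.integral_sub (intervalIntegrable k hf) (intervalIntegrable k hg)

lemma integral_congr {f g : ℂ → E} (h : ∀ z ∈ Γ.support, f z = g z) :
    Γ.integral f = Γ.integral g := by
  refine Finset.sum_congr rfl fun k _ => intervalIntegral.integral_congr fun t ht => ?_
  rw [uIcc_of_le zero_le_one] at ht
  simp only [h _ (Γ.arc_mem_support k ht)]

lemma map_integral {F : Type*} [NormedAddCommGroup F] [NormedSpace ℂ F] [CompleteSpace E]
    [CompleteSpace F] (L : E →L[ℂ] F) {f : ℂ → E} (hf : ContinuousOn f Γ.support) :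
    L (Γ.integral f) = Γ.integral (fun z => L (f z)) := by
  simp only [integral, map_sum]
  refine Finset.sum_congr rfl fun k _ => ?_
  rw [← L.intervalIntegral_comp_comm (intervalIntegrable k hf)]
  simp

/-- The integral of a derivative along a contour vanishes. -/
lemma integral_deriv_eq_zero [CompleteSpace E] {F f : ℂ → E}
    (hF : ∀ z ∈ Γ.support, HasDerivAt F (f z) z) (hf : ContinuousOn f Γ.support) :
    Γ.integral f = 0 := by
  have h : ∀ k, ∫ t in (0 : ℝ)..1, deriv (Γ.arc k) t • f (Γ.arc k t) =
      F (Γ.arc k 1) - F (Γ.arc k 0) := fun k => by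
    refine intervalIntegral.integral_eq_sub_of_hasDerivAt_of_le zero_le_one ?_ ?_
      (intervalIntegrable k hf) (f := fun t => F (Γ.arc k t))
    · have hFc : ContinuousOn F Γ.support := fun z hz => (hF z hz).continuousAt.continuousWithinAt
      exact hFc.comp (Γ.continuousOn_arc k) fun t ht => Γ.arc_mem_support k ht
    · intro t ht
      exact (hF _ (Γ.arc_mem_support k ⟨ht.1.le, ht.2.le⟩)).scomp t (Γ.hasDerivAt_arc k ht)
  simp only [integral, h, Finset.sum_sub_distrib, Γ.closes]
  -- The final points of the arcs are the initial points permuted by `next`, so the boundary terms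
  -- cancel.
  rw [Equiv.sum_comp Γ.next (fun k => F (Γ.arc k 0)), sub_self]

lemma continuousOn_inv_sub {w : ℂ} (hw : w ∉ Γ.support) :
    ContinuousOn (fun z => (z - w)⁻¹) Γ.support :=
  (continuousOn_id.sub continuousOn_const).inv₀ fun _ hz =>
    sub_ne_zero.2 fun h : _ = w => hw (h ▸ hz)

lemma continuousOn_inv_sub_sq {w : ℂ} (hw : w ∉ Γ.support) :
    ContinuousOn (fun z => ((z - w) ^ 2)⁻¹) Γ.support :=
  ((continuousOn_id.sub continuousOn_const).pow 2).inv₀ fun _ hz =>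
    pow_ne_zero 2 (sub_ne_zero.2 fun h : _ = w => hw (h ▸ hz))

/-- Differentiation of a Cauchy transform. -/
lemma hasDerivAt_cauchyTransform {f : ℂ → E} (hf : ContinuousOn f Γ.support) {w : ℂ}
    (hw : w ∉ Γ.support) :
    HasDerivAt (fun w => Γ.integral (fun z => (z - w)⁻¹ • f z))
      (Γ.integral (fun z => ((z - w) ^ 2)⁻¹ • f z)) w := by
  obtain ⟨r, hr, hball⟩ := Metric.isOpen_iff.1 Γ.isClosed_support.isOpen_compl w hw
  refine HasDerivAt.fun_sum fun k _ => ?_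
  refine (intervalIntegral.hasDerivAt_integral_of_dominated_loc_of_deriv_le
    (bound := fun t => ((r / 2) ^ 2)⁻¹ * ‖deriv (Γ.arc k) t • f (Γ.arc k t)‖)
    (F := fun w t => deriv (Γ.arc k) t • (Γ.arc k t - w)⁻¹ • f (Γ.arc k t))
    (F' := fun w t => deriv (Γ.arc k) t • ((Γ.arc k t - w) ^ 2)⁻¹ • f (Γ.arc k t))
    (Metric.ball_mem_nhds w (half_pos hr)) ?_ ?_ ?_ ?_ ?_ ?_).2
  · filter_upwards [Γ.isClosed_support.isOpen_compl.mem_nhds hw] with v hv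
    exact (intervalIntegrable k ((continuousOn_inv_sub hv).smul hf)).aestronglyMeasurable_restrict_uIoc
  · exact intervalIntegrable k ((continuousOn_inv_sub hw).smul hf)
  · exact (intervalIntegrable k
      ((continuousOn_inv_sub_sq hw).smul hf)).aestronglyMeasurable_restrict_uIoc
  · refine Eventually.of_forall fun t ht v hv => ?_
    rw [uIoc_of_le zero_le_one] at ht
    have hz := Γ.arc_mem_support k ⟨ht.1.le, ht.2⟩
    have hd : r / 2 ≤ ‖Γ.arc k t - v‖ := by
      by_contra! hlt
      refine hball (a := Γ.arc k t) ?_ hz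
      rw [Metric.mem_ball] at hv ⊢
      rw [← dist_eq_norm] at hlt
      linarith [dist_triangle (Γ.arc k t) v w]
    rw [smul_comm, norm_smul, norm_inv, norm_pow]
    gcongr
  · exact ((intervalIntegrable k hf).norm).const_mul _
  · refine Eventually.of_forall fun t ht v hv => ?_
    rw [uIoc_of_le zero_le_one] at ht
    have hz := Γ.arc_mem_support k ⟨ht.1.le, ht.2⟩
    have hne : Γ.arc k t - v ≠ 0 := sub_ne_zero.2 fun h => by
      refine hball (a := v) (Metric.ball_subset_ball (half_le_self hr.le) hv) (h ▸ hz)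
    have h1 : HasDerivAt (fun v => (Γ.arc k t - v)⁻¹) ((Γ.arc k t - v) ^ 2)⁻¹ v := by
      have := ((hasDerivAt_id v).const_sub (Γ.arc k t)).fun_inv hne
      simpa [neg_div] using this
    exact (h1.smul_const _).const_smul _

lemma wind_eq (w : ℂ) :
    Γ.wind w = (2 * Real.pi * Complex.I)⁻¹ * Γ.integral (fun z => (z - w)⁻¹) := by
  simp only [wind, integral, div_eq_mul_inv, smul_eq_mul]

/-- Winding numbers are locally constant. -/
lemma eventually_wind_eq {w : ℂ} (hw : w ∉ Γ.support) :
    ∀ᶠ v in 𝓝 w, Γ.wind v = Γ.wind w := by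
  have hder : ∀ v ∉ Γ.support, HasDerivAt Γ.wind 0 v := fun v hv => by
    have h1 := hasDerivAt_cauchyTransform (Γ := Γ) (f := fun _ => (1 : ℂ)) continuousOn_const hv
    -- The derivative of the winding integral in `v` is the integral of an exact form, with
    -- primitive `-(z - v)⁻¹`.
    have h2 : Γ.integral (fun z => ((z - v) ^ 2)⁻¹ • (1 : ℂ)) = 0 := by
      refine integral_deriv_eq_zero (F := fun z => -(z - v)⁻¹) (fun z hz => ?_)
        ((continuousOn_inv_sub_sq hv).smul continuousOn_const)
      have hne : z - v ≠ 0 := sub_ne_zero.2 fun h => hv (h ▸ hz)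
      have := (((hasDerivAt_id z).sub_const v).fun_inv hne).fun_neg
      simpa [neg_div] using this
    rw [h2] at h1
    have h3 := h1.const_mul (2 * Real.pi * Complex.I)⁻¹
    rw [mul_zero] at h3
    refine h3.congr_of_eventuallyEq (Eventually.of_forall fun v => ?_)
    simp [wind_eq]
  obtain ⟨r, hr, hball⟩ := Metric.isOpen_iff.1 Γ.isClosed_support.isOpen_compl w hw
  filter_upwards [Metric.ball_mem_nhds w hr] with v hv
  refine (convex_ball w r).is_const_of_fderivWithin_eq_zero (𝕜 := ℂ) (f := Γ.wind)
    (fun x hx => (hder x (hball hx)).differentiableAt.differentiableWithinAt) (fun x hx => ?_)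
    hv (Metric.mem_ball_self hr)
  rw [fderivWithin_of_isOpen Metric.isOpen_ball hx]
  ext
  simp [(hder x (hball hx)).deriv]

end Contour

/-! ### Spectral splittings in a complex Banach algebra and their uniqueness. -/

section Splitting

variable {A : Type*} [NormedRing A] [NormedAlgebra ℂ A]

lemma resolvent_mul_sub {T : A} {z : ℂ} (hz : z ∉ spectrum ℂ T) :
    resolvent T z * (algebraMap ℂ A z - T) = 1 :=
  Ring.inverse_mul_cancel _ (not_not.1 hz)

lemma sub_mul_resolvent {T : A} {z : ℂ} (hz : z ∉ spectrum ℂ T) :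
    (algebraMap ℂ A z - T) * resolvent T z = 1 :=
  Ring.mul_inverse_cancel _ (not_not.1 hz)

lemma commute_resolvent {T P : A} (h : Commute T P) {z : ℂ} (hz : z ∉ spectrum ℂ T) :
    Commute (resolvent T z) P := by
  have h1 : Commute (algebraMap ℂ A z - T) P := (Algebra.commute_algebraMap_left z P).sub_left h
  calc resolvent T z * P
      = resolvent T z * (P * (algebraMap ℂ A z - T)) * resolvent T z := by
        rw [mul_assoc, mul_assoc, sub_mul_resolvent hz, mul_one]
    _ = P * resolvent T z := by
        rw [← h1.eq, ← mul_assoc, resolvent_mul_sub hz, one_mul]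

/-- `P` splits the resolvent of `T` along the decomposition `S₁ ∪ S₂` of the spectrum: it commutes
with `T`, and `(z - T)⁻¹ (1 - P)` continues analytically to `S₁`, while `(z - T)⁻¹ P` continues
analytically to `S₂`. -/
structure IsSpectralSplitting (T : A) (S₁ S₂ : Set ℂ) (P : A) : Prop where
  commute : Commute T P
  exists_continuation : ∃ G : ℂ → A,
    (∀ w ∈ S₁ ∪ S₂, Commute T (G w)) ∧
    (∀ w ∈ S₁, DifferentiableAt ℂ G w ∧ ∀ᶠ v in 𝓝 w, (algebraMap ℂ A v - T) * G v = 1 - P) ∧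
    (∀ w ∈ S₂, DifferentiableAt ℂ G w ∧ ∀ᶠ v in 𝓝 w, (algebraMap ℂ A v - T) * G v = -P)

namespace IsSpectralSplitting

variable {T P P' : A} {S₁ S₂ : Set ℂ}

/-- The function `(z - T)⁻¹ P (1 - P')` extends over `S₁` because `(z - T)⁻¹(1 - P')` does, and over
`S₂` because `(z - T)⁻¹ P` does. It is then entire and tends to `0` at infinity, so Liouville's
theorem makes it vanish. -/
lemma mul_one_sub_eq_zero [CompleteSpace A] (hP : IsSpectralSplitting T S₁ S₂ P)
    (hP' : IsSpectralSplitting T S₁ S₂ P') (hS : spectrum ℂ T = S₁ ∪ S₂)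
    (h₁ : IsClosed S₁) (h₂ : IsClosed S₂) (hd : Disjoint S₁ S₂) : P * (1 - P') = 0 := by
  classical
  obtain ⟨G, -, -, hG⟩ := hP.exists_continuation
  obtain ⟨G', -, hG', -⟩ := hP'.exists_continuation
  -- On the spectrum `F` takes the values of the two continuations: `G'` satisfies `(v - T) G' = 1 -
  -- P'` near `S₁`, and `G` satisfies `(v - T) G = -P` near `S₂`.
  set F : ℂ → A := fun z => if z ∈ S₁ then P * G' z else
    if z ∈ S₂ then -(G z * (1 - P')) else resolvent T z * (P * (1 - P')) with hF
  have hF0 : ∀ z ∉ spectrum ℂ T, F z = resolvent T z * (P * (1 - P')) := fun z hz => by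
    rw [hS, mem_union, not_or] at hz
    simp only [hF, if_neg hz.1, if_neg hz.2]
  have hdiff : Differentiable ℂ F := by
    intro w
    by_cases hw1 : w ∈ S₁
    · have hw2 : w ∉ S₂ := hd.notMem_of_mem_left hw1
      refine ((hG' w hw1).1.const_mul P).congr_of_eventuallyEq ?_
      filter_upwards [(hG' w hw1).2, h₂.isOpen_compl.mem_nhds hw2] with v hv hv2
      by_cases hv1 : v ∈ S₁
      · simp only [hF, if_pos hv1]
      · have hvs : v ∉ spectrum ℂ T := by rw [hS]; exact fun h => h.elim hv1 hv2
        rw [hF0 v hvs, ← hv, ← mul_assoc, ← mul_assoc, (commute_resolvent hP.commute hvs).eq,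
          mul_assoc P, resolvent_mul_sub hvs, mul_one]
    by_cases hw2 : w ∈ S₂
    · refine ((hG w hw2).1.mul_const (1 - P')).neg.congr_of_eventuallyEq ?_
      filter_upwards [(hG w hw2).2, h₁.isOpen_compl.mem_nhds hw1] with v hv hv1
      by_cases hv2 : v ∈ S₂
      · simp only [hF, if_neg (show v ∉ S₁ from hv1), if_pos hv2, Pi.neg_apply]
      · have hvs : v ∉ spectrum ℂ T := by rw [hS]; exact fun h => h.elim hv1 hv2
        rw [hF0 v hvs, ← mul_assoc, (neg_eq_iff_eq_neg.2 hv).symm, mul_neg, ← mul_assoc,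
          resolvent_mul_sub hvs, one_mul, Pi.neg_apply, neg_mul]
    · have hws : w ∉ spectrum ℂ T := by rw [hS]; exact fun h => h.elim hw1 hw2
      have h3 : DifferentiableAt ℂ (fun v => resolvent T v * (P * (1 - P'))) w :=
        (spectrum.hasDerivAt_resolvent_const_left (not_not.1 hws)).differentiableAt.mul_const _
      refine h3.congr_of_eventuallyEq ?_
      filter_upwards [(spectrum.isClosed T).isOpen_compl.mem_nhds hws] with v hv
      exact hF0 v hv
  have hev : ∀ᶠ z in Bornology.cobounded ℂ, z ∉ spectrum ℂ T :=
    Bornology.isBounded_def.1 (spectrum.isCompact (𝕜 := ℂ) T).isBounded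
  have hlim : Tendsto F (cocompact ℂ) (𝓝 0) := by
    rw [← Metric.cobounded_eq_cocompact]
    have h4 := (spectrum.resolvent_tendsto_cobounded (𝕜 := ℂ) T).mul_const (P * (1 - P'))
    rw [zero_mul] at h4
    refine h4.congr' ?_
    filter_upwards [hev] with z hz using (hF0 z hz).symm
  obtain ⟨z, hz⟩ := hev.exists
  have h5 := hdiff.apply_eq_of_tendsto_cocompact z hlim
  rw [hF0 z hz] at h5
  calc P * (1 - P') = (algebraMap ℂ A z - T) * (resolvent T z * (P * (1 - P'))) := by
        rw [← mul_assoc, sub_mul_resolvent hz, one_mul]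
    _ = 0 := by rw [h5, mul_zero]

lemma mul_self [CompleteSpace A] (hP : IsSpectralSplitting T S₁ S₂ P)
    (hS : spectrum ℂ T = S₁ ∪ S₂) (h₁ : IsClosed S₁) (h₂ : IsClosed S₂)
    (hd : Disjoint S₁ S₂) : P * P = P := by
  have h := hP.mul_one_sub_eq_zero hP hS h₁ h₂ hd
  rw [mul_sub, mul_one, sub_eq_zero] at h
  exact h.symm

/-- The same continuation identities hold for the complementary part. -/
lemma compl (hP : IsSpectralSplitting T S₁ S₂ P) : IsSpectralSplitting T S₂ S₁ (1 - P) := by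
  obtain ⟨G, h0, h1, h2⟩ := hP.exists_continuation
  refine ⟨(Commute.one_right T).sub_right hP.commute, fun z => -G z,
    fun w hw => (h0 w hw.symm).neg_right, fun w hw => ?_, fun w hw => ?_⟩
  · refine ⟨(h2 w hw).1.fun_neg, (h2 w hw).2.mono fun v hv => ?_⟩
    rw [mul_neg, hv, neg_neg, sub_sub_cancel]
  · refine ⟨(h1 w hw).1.fun_neg, (h1 w hw).2.mono fun v hv => ?_⟩
    rw [mul_neg, hv]

/-- The vanishing of `P(1 - P')`, and of `(1 - P)P'` for the complementary splittings, gives `P =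
PP' = P'`. -/
lemma unique [CompleteSpace A] (hP : IsSpectralSplitting T S₁ S₂ P)
    (hP' : IsSpectralSplitting T S₁ S₂ P') (hS : spectrum ℂ T = S₁ ∪ S₂)
    (h₁ : IsClosed S₁) (h₂ : IsClosed S₂) (hd : Disjoint S₁ S₂) : P = P' := by
  have h3 := hP.mul_one_sub_eq_zero hP' hS h₁ h₂ hd
  have h4 := hP.compl.mul_one_sub_eq_zero hP'.compl (by rw [hS, union_comm]) h₂ h₁ hd.symm
  rw [sub_sub_cancel, sub_mul, one_mul, sub_eq_zero] at h4
  rw [mul_sub, mul_one, sub_eq_zero] at h3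
  rw [h3, ← h4]

/-- With `P = 0` the continuation would supply a right inverse of `w - T` at a point of `S₁`. As it
commutes with `T`, this inverse is two-sided, contradicting `w ∈ spectrum ℂ T`. -/
lemma ne_zero (hP : IsSpectralSplitting T S₁ S₂ P) (hS : spectrum ℂ T = S₁ ∪ S₂)
    (hne : S₁.Nonempty) : P ≠ 0 := by
  rintro rfl
  obtain ⟨w, hw⟩ := hne
  obtain ⟨G, h0, h1, -⟩ := hP.exists_continuation
  have h2 : (algebraMap ℂ A w - T) * G w = 1 := by
    rw [(h1 w hw).2.self_of_nhds, sub_zero]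
  have h3 : Commute (algebraMap ℂ A w - T) (G w) :=
    (Algebra.commute_algebraMap_left w _).sub_left (h0 w (Or.inl hw))
  have h4 : w ∈ spectrum ℂ T := hS ▸ Or.inl hw
  exact h4 ⟨⟨_, G w, h2, h3.eq ▸ h2⟩, rfl⟩

lemma ne_one (hP : IsSpectralSplitting T S₁ S₂ P) (hS : spectrum ℂ T = S₁ ∪ S₂)
    (hne : S₂.Nonempty) : P ≠ 1 := by
  rintro rfl
  exact hP.compl.ne_zero (by rw [hS, union_comm]) hne (sub_self 1)

/-- Splittings are mapped to splittings by conjugate-linear symmetries that fix `T`. -/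
lemma map_conj (hP : IsSpectralSplitting T S₁ S₂ P) (κ : A →+* A) (hκ : Continuous κ)
    (hκs : ∀ (c : ℂ) (a : A), κ (c • a) = conj c • κ a) (hT : κ T = T)
    (h₁ : ∀ z ∈ S₁, conj z ∈ S₁) (h₂ : ∀ z ∈ S₂, conj z ∈ S₂) :
    IsSpectralSplitting T S₁ S₂ (κ P) := by
  obtain ⟨G, hG0, hG1, hG2⟩ := hP.exists_continuation
  have hd : ∀ w, DifferentiableAt ℂ G (conj w) → DifferentiableAt ℂ (fun z => κ (G (conj z))) w := by
    intro w hw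
    have h := hw.hasDerivAt
    refine HasDerivAt.differentiableAt (f' := κ (deriv G (conj w))) ?_
    rw [hasDerivAt_iff_tendsto_slope] at h ⊢
    have hc : Tendsto (conj : ℂ → ℂ) (𝓝[≠] w) (𝓝[≠] (conj w)) :=
      Complex.continuous_conj.continuousAt.continuousWithinAt.tendsto_nhdsWithin
        fun v hv hvw => hv ((starRingEnd ℂ).injective hvw)
    -- Difference quotients go to difference quotients: the conjugation from `κ` undoes the one in
    -- the argument.
    refine ((hκ.tendsto _).comp (h.comp hc)).congr fun v => ?_
    simp only [Function.comp, slope, vsub_eq_sub, hκs, map_sub, map_inv₀, Complex.conj_conj]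
  have hal : ∀ v, κ (algebraMap ℂ A (conj v) - T) = algebraMap ℂ A v - T := fun v => by
    rw [map_sub, hT, Algebra.algebraMap_eq_smul_one, hκs, map_one, Complex.conj_conj,
      Algebra.algebraMap_eq_smul_one]
  have hc : ∀ w, Tendsto (conj : ℂ → ℂ) (𝓝 w) (𝓝 (conj w)) := fun w =>
    Complex.continuous_conj.tendsto w
  refine ⟨?_, fun z => κ (G (conj z)), fun w hw => ?_, fun w hw => ⟨hd w (hG1 _ (h₁ w hw)).1, ?_⟩,
    fun w hw => ⟨hd w (hG2 _ (h₂ w hw)).1, ?_⟩⟩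
  · have := hP.commute.map κ
    rwa [hT] at this
  · have := (hG0 _ (hw.imp (h₁ w) (h₂ w))).map κ
    rwa [hT] at this
  · filter_upwards [(hc w).eventually (hG1 _ (h₁ w hw)).2] with v hv
    rw [← hal, ← map_mul, hv, map_sub, map_one]
  · filter_upwards [(hc w).eventually (hG2 _ (h₂ w hw)).2] with v hv
    rw [← hal, ← map_mul, hv, map_neg]

end IsSpectralSplitting

/-- The Riesz integral `(2πi)⁻¹ ∫_Γ (z - T)⁻¹ dz` in a complex Banach algebra. -/
noncomputable def Contour.riesz (Γ : Contour) (T : A) : A :=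
  (2 * Real.pi * Complex.I)⁻¹ • Γ.integral (resolvent T)

variable [CompleteSpace A] {Γ : Contour} {T : A}

lemma continuousOn_resolvent : ContinuousOn (resolvent T) (spectrum ℂ T)ᶜ := fun _ hz =>
  (spectrum.hasDerivAt_resolvent_const_left (not_not.1 hz)).continuousAt.continuousWithinAt

/-- Writing `w - T = (z - T) - (z - w)` turns the integrand into `(z - w)⁻¹ - (z - T)⁻¹`; the two
terms integrate to the winding number and the Riesz integral. -/
lemma Contour.sub_mul_cauchyTransform (hΓ : Disjoint Γ.support (spectrum ℂ T)) {w : ℂ}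
    (hw : w ∉ Γ.support) :
    (algebraMap ℂ A w - T) * ((2 * Real.pi * Complex.I)⁻¹ •
      Γ.integral (fun z => (z - w)⁻¹ • resolvent T z)) =
      algebraMap ℂ A (Γ.wind w) - Γ.riesz T := by
  have hR : ContinuousOn (resolvent T) Γ.support :=
    continuousOn_resolvent.mono hΓ.subset_compl_right
  have h1 := map_integral (ContinuousLinearMap.mul ℂ A (algebraMap ℂ A w - T))
    ((continuousOn_inv_sub hw).smul hR)
  have h2 := map_integral ((ContinuousLinearMap.id ℂ ℂ).smulRight (1 : A))
    (continuousOn_inv_sub hw)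
  have h3 : Γ.integral (fun z => (algebraMap ℂ A w - T) * ((z - w)⁻¹ • resolvent T z)) =
      Γ.integral (fun z => (z - w)⁻¹ • (1 : A) - resolvent T z) := by
    refine integral_congr fun z hz => ?_
    have hzw : z - w ≠ 0 := sub_ne_zero.2 fun h : z = w => hw (h ▸ hz)
    have h4 : algebraMap ℂ A w - T = (algebraMap ℂ A z - T) - (z - w) • (1 : A) := by
      rw [← Algebra.algebraMap_eq_smul_one, map_sub]; abel
    rw [mul_smul_comm, h4, sub_mul, sub_mul_resolvent (hΓ.notMem_of_mem_left hz), smul_mul_assoc,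
      one_mul, smul_sub, inv_smul_smul₀ hzw]
  rw [integral_sub (f := fun z => (z - w)⁻¹ • (1 : A))
    ((continuousOn_inv_sub hw).smul continuousOn_const) hR] at h3
  simp only [ContinuousLinearMap.mul_apply', ContinuousLinearMap.smulRight_apply,
    ContinuousLinearMap.id_apply, Pi.smul_apply'] at h1 h2
  rw [show (fun z => (z - w)⁻¹ • resolvent T z) = (fun z => (z - w)⁻¹) • resolvent T from rfl]
  rw [mul_smul_comm, h1, h3, ← h2, smul_sub, smul_smul, riesz, wind_eq,
    Algebra.algebraMap_eq_smul_one]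

lemma Contour.commute_integral {f : ℂ → A} (hf : ContinuousOn f Γ.support)
    (hT : ∀ z ∈ Γ.support, Commute T (f z)) : Commute T (Γ.integral f) := by
  have h1 := map_integral (ContinuousLinearMap.mul ℂ A T) hf
  have h2 := map_integral ((ContinuousLinearMap.mul ℂ A).flip T) hf
  have h3 : Γ.integral (fun z => T * f z) = Γ.integral (fun z => f z * T) :=
    integral_congr fun z hz => (hT z hz).eq
  simp only [ContinuousLinearMap.mul_apply', ContinuousLinearMap.flip_apply] at h1 h2
  rw [Commute, SemiconjBy, h1, h2, h3]

/-- The Riesz integral over a separating contour splits the resolvent. -/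
lemma Contour.isSpectralSplitting_riesz {S₁ S₂ : Set ℂ} (hS : spectrum ℂ T = S₁ ∪ S₂)
    (hΓ : Disjoint Γ.support (spectrum ℂ T)) (h₁ : ∀ z ∈ S₁, Γ.wind z = 1)
    (h₂ : ∀ z ∈ S₂, Γ.wind z = 0) : IsSpectralSplitting T S₁ S₂ (Γ.riesz T) := by
  have hR : ContinuousOn (resolvent T) Γ.support :=
    continuousOn_resolvent.mono hΓ.subset_compl_right
  have hd : ∀ w ∈ S₁ ∪ S₂, w ∉ Γ.support := fun w hw =>
    hΓ.notMem_of_mem_right (hS ▸ hw)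
  have key : ∀ w ∉ Γ.support, ∀ᶠ v in 𝓝 w, (algebraMap ℂ A v - T) *
      ((2 * Real.pi * Complex.I)⁻¹ • Γ.integral (fun z => (z - v)⁻¹ • resolvent T z)) =
      algebraMap ℂ A (Γ.wind w) - Γ.riesz T := fun w hw => by
    filter_upwards [Γ.isClosed_support.isOpen_compl.mem_nhds hw, eventually_wind_eq hw] with v hv hvw
    rw [sub_mul_cauchyTransform hΓ hv, hvw]
  have hc : ∀ z ∈ Γ.support, Commute T (resolvent T z) := fun z hz =>
    (commute_resolvent (Commute.refl T) (hΓ.notMem_of_mem_left hz)).symm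
  refine ⟨(commute_integral hR hc).smul_right _, fun w => (2 * Real.pi * Complex.I)⁻¹ •
    Γ.integral (fun z => (z - w)⁻¹ • resolvent T z), fun w hw => ?_, fun w hw => ?_, fun w hw => ?_⟩
  · exact (commute_integral ((continuousOn_inv_sub (hd w hw)).smul hR)
      fun z hz => (hc z hz).smul_right _).smul_right _
  · have hw' := hd w (Or.inl hw)
    refine ⟨(hasDerivAt_cauchyTransform hR hw').differentiableAt.fun_const_smul _, ?_⟩
    simpa [h₁ w hw] using key w hw'
  · have hw' := hd w (Or.inr hw)
    refine ⟨(hasDerivAt_cauchyTransform hR hw').differentiableAt.fun_const_smul _, ?_⟩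
    simpa [h₂ w hw] using key w hw'

end Splitting

/-! ### Contours around a compact set, built from the edges of a square grid -/

namespace Grid

/-- A square of the grid with mesh `2h` is given by the integer coordinates `c` of its centre
`2hc`; its sides are numbered counterclockwise, beginning with the right one. -/
abbrev Edge := (ℤ × ℤ) × Fin 4

/-- The square on the other side of an edge. -/
def neighbour (e : Edge) : ℤ × ℤ :=
  (e.1.1 + ![1, 0, -1, 0] e.2, e.1.2 + ![0, 1, 0, -1] e.2)

/-- The same edge with the opposite orientation. -/
def flip (e : Edge) : Edge := (neighbour e, e.2 + 2)

/-- The initial point of an edge. -/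
noncomputable def start (h : ℝ) (e : Edge) : ℂ :=
  ⟨h * (2 * e.1.1 + ![1, 1, -1, -1] e.2), h * (2 * e.1.2 + ![-1, 1, 1, -1] e.2)⟩

/-- The final point of an edge. -/
noncomputable def finish (h : ℝ) (e : Edge) : ℂ := start h (e.1, e.2 + 1)

lemma flip_flip (e : Edge) : flip (flip e) = e := by
  obtain ⟨⟨a, b⟩, d⟩ := e
  fin_cases d <;> simp [flip, neighbour]

lemma neighbour_flip (e : Edge) : neighbour (flip e) = e.1 :=
  congrArg Prod.fst (flip_flip e)

lemma flip_ne (e : Edge) : flip e ≠ e := by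
  obtain ⟨⟨a, b⟩, d⟩ := e
  intro h
  have h2 := congrArg Prod.snd h
  fin_cases d <;> simp [flip] at h2

lemma start_flip (h : ℝ) (e : Edge) : start h (flip e) = finish h e := by
  obtain ⟨⟨a, b⟩, d⟩ := e
  fin_cases d <;> simp [flip, neighbour, start, finish] <;> ring_nf <;> simp

lemma finish_flip (h : ℝ) (e : Edge) : finish h (flip e) = start h e := by
  rw [← start_flip, flip_flip]

/-- The boundary edges of a finite set of squares. -/
def boundary (Q : Finset (ℤ × ℤ)) : Finset Edge :=
  (Q ×ˢ Finset.univ).filter fun e => neighbour e ∉ Q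

lemma mem_boundary {Q : Finset (ℤ × ℤ)} {e : Edge} :
    e ∈ boundary Q ↔ e.1 ∈ Q ∧ neighbour e ∉ Q := by
  simp [boundary]

/-- In a sum over all edges of a set of squares, the interior edges cancel. -/
lemma sum_boundary {M : Type*} [AddCommGroup M] (Q : Finset (ℤ × ℤ)) (φ : Edge → M)
    (hφ : ∀ e, φ (flip e) = -φ e) : ∑ e ∈ boundary Q, φ e = ∑ c ∈ Q, ∑ d, φ (c, d) := by
  rw [← Finset.sum_product', ← Finset.sum_filter_not_add_sum_filter (Q ×ˢ Finset.univ) (fun e => neighbour e ∈ Q)]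
  have : ∑ e ∈ (Q ×ˢ Finset.univ).filter (fun e => neighbour e ∈ Q), φ e = 0 := by
    refine Finset.sum_involution (fun e _ => flip e) (fun e _ => ?_) (fun e _ _ => flip_ne e)
      (fun e he => ?_) (fun e _ => flip_flip e)
    · rw [hφ, add_neg_cancel]
    · simp only [Finset.mem_filter, Finset.mem_product, Finset.mem_univ, and_true] at he ⊢
      exact ⟨he.2, by rw [neighbour_flip]; exact he.1⟩
  rw [this, add_zero, boundary]

/-- Interior edges may be added back because they cancel in pairs, and then the sum telescopes
around each square. -/
lemma sum_boundary_sub {M : Type*} [AddCommGroup M] (Q : Finset (ℤ × ℤ)) (h : ℝ) (g : ℂ → M) :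
    ∑ e ∈ boundary Q, (g (finish h e) - g (start h e)) = 0 := by
  rw [sum_boundary Q (fun e => g (finish h e) - g (start h e)) fun e => by
    rw [finish_flip, start_flip, neg_sub]]
  refine Finset.sum_eq_zero fun c _ => ?_
  rw [Finset.sum_sub_distrib, sub_eq_zero]
  exact Equiv.sum_comp (Equiv.addRight (1 : Fin 4)) fun d => g (start h (c, d))

/-- If as many arrows begin as end at each point, the arrows can be arranged in cycles. -/
lemma exists_perm {α V : Type*} [Fintype α] [DecidableEq V] (s t : α → V)
    (h : ∀ v, Fintype.card {a // t a = v} = Fintype.card {a // s a = v}) :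
    ∃ π : Equiv.Perm α, ∀ a, t a = s (π a) := by
  refine ⟨(Equiv.sigmaFiberEquiv t).symm.trans
    ((Equiv.sigmaCongrRight fun v => Fintype.equivOfCardEq (h v)).trans
      (Equiv.sigmaFiberEquiv s)), fun a => ?_⟩
  exact ((Fintype.equivOfCardEq (h (t a))) ⟨a, rfl⟩).2.symm

/-- Telescoping with the indicator function of a vertex shows that as many boundary edges end there
as begin there. Vertices where squares of `Q` touch only at a corner need no special treatment. -/
lemma exists_next (Q : Finset (ℤ × ℤ)) (h : ℝ) :
    ∃ π : Equiv.Perm (boundary Q), ∀ e : boundary Q, finish h e = start h (π e) := by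
  classical
  refine exists_perm (fun e : boundary Q => start h e) (fun e : boundary Q => finish h e) fun v => ?_
  have h1 := sum_boundary_sub Q h (fun z => if z = v then (1 : ℤ) else 0)
  rw [Finset.sum_sub_distrib, sub_eq_zero, ← Finset.sum_coe_sort,
    ← Finset.sum_coe_sort (boundary Q)] at h1
  simp only [Finset.sum_boole] at h1
  rw [Fintype.card_subtype, Fintype.card_subtype]
  exact_mod_cast h1

/-- The segment from `a` to `b`. -/
noncomputable def segment (a b : ℂ) (t : ℝ) : ℂ := a + t * (b - a)

lemma hasDerivAt_segment (a b : ℂ) (t : ℝ) : HasDerivAt (segment a b) (b - a) t :=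
  (((Complex.ofRealCLM.hasDerivAt (x := t)).mul_const (b - a)).const_add a).congr_deriv (by simp)

lemma contDiff_segment (a b : ℂ) : ContDiff ℝ 1 (segment a b) :=
  contDiff_const.add (Complex.ofRealCLM.contDiff.mul contDiff_const)

/-- The contour that consists of the boundary edges of a finite set of squares. -/
lemma exists_boundary_contour (Q : Finset (ℤ × ℤ)) (h : ℝ) :
    ∃ Γ : Contour, (∀ z ∈ Γ.support, ∃ e ∈ boundary Q, ∃ t ∈ Icc (0 : ℝ) 1,
        z = segment (start h e) (finish h e) t) ∧
      ∀ w, Γ.wind w = (2 * Real.pi * Complex.I)⁻¹ * ∑ e ∈ boundary Q,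
        ∫ t in (0 : ℝ)..1, (finish h e - start h e) / (segment (start h e) (finish h e) t - w) := by
  obtain ⟨π, hπ⟩ := exists_next Q h
  let ε := Fintype.equivFin (boundary Q)
  refine ⟨⟨_, fun k => segment (start h (ε.symm k)) (finish h (ε.symm k)),
    (ε.symm.trans π).trans ε, fun k => (contDiff_segment _ _).contDiffOn, fun k => ?_⟩, ?_, ?_⟩
  · simp [segment, hπ]
  · intro z hz
    obtain ⟨k, t, ht, rfl⟩ := mem_iUnion.1 hz
    exact ⟨_, (ε.symm k).2, t, ht, rfl⟩
  · intro w
    rw [Contour.wind]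
    simp only [(hasDerivAt_segment _ _ _).deriv]
    rw [← Finset.sum_coe_sort (boundary Q), ← Equiv.sum_comp ε.symm]

lemma segment_one_sub (a b : ℂ) (t : ℝ) : segment a b (1 - t) = segment b a t := by
  simp [segment]; ring

/-- The constant `c` rotates the segment, seen from `w`, off the branch cut of the logarithm; it
cancels in the logarithmic derivative. -/
lemma integral_segment {a b w c : ℂ}
    (h : ∀ t ∈ Icc (0 : ℝ) 1, (segment a b t - w) * c ∈ Complex.slitPlane) :
    ∫ t in (0 : ℝ)..1, (b - a) / (segment a b t - w) =
      Complex.log ((b - w) * c) - Complex.log ((a - w) * c) := by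
  have hder : ∀ t ∈ Icc (0 : ℝ) 1, HasDerivAt (fun t => Complex.log ((segment a b t - w) * c))
      ((b - a) / (segment a b t - w)) t := fun t ht => by
    have h1 := (((hasDerivAt_segment a b t).sub_const w).mul_const c).clog_real (h t ht)
    have hc : c ≠ 0 := right_ne_zero_of_mul (Complex.slitPlane_ne_zero (h t ht))
    rwa [mul_div_mul_right _ _ hc] at h1
  have hc : ContinuousOn (fun t => (b - a) / (segment a b t - w)) (uIcc 0 1) := by
    rw [uIcc_of_le zero_le_one]
    exact continuousOn_const.div (((contDiff_segment a b).continuous.sub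
      continuous_const).continuousOn) fun t ht =>
      left_ne_zero_of_mul (Complex.slitPlane_ne_zero (h t ht))
  rw [intervalIntegral.integral_eq_sub_of_hasDerivAt (fun t ht => hder t ?_)
    hc.intervalIntegrable]
  · simp [segment]
  · rwa [uIcc_of_le zero_le_one] at ht

lemma integral_segment_flip (a b w : ℂ) :
    ∫ t in (0 : ℝ)..1, (a - b) / (segment b a t - w) =
      -∫ t in (0 : ℝ)..1, (b - a) / (segment a b t - w) := by
  have h1 := intervalIntegral.integral_comp_sub_left (a := 0) (b := 1)
    (fun t => (b - a) / (segment a b t - w)) (1 : ℝ)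
  rw [sub_zero, sub_self] at h1
  rw [← h1, ← intervalIntegral.integral_neg]
  refine intervalIntegral.integral_congr fun t _ => ?_
  simp only [segment_one_sub]
  ring

/-- The integral of `dz / (z - w)` over the boundary of a square. -/
noncomputable def cellIntegral (h : ℝ) (w : ℂ) (c : ℤ × ℤ) : ℂ :=
  ∑ d, ∫ t in (0 : ℝ)..1, (finish h (c, d) - start h (c, d)) /
    (segment (start h (c, d)) (finish h (c, d)) t - w)

/-- The corners, and hence the whole boundary, lie in an open half-plane whose edge passes through
`w`. One branch of the logarithm serves all four sides, and the sum telescopes. -/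
lemma cellIntegral_eq_zero {h : ℝ} {w : ℂ} {c : ℤ × ℤ} (v : ℂ)
    (hv : ∀ d, 0 < ((start h (c, d) - w) * v).re) : cellIntegral h w c = 0 := by
  have h1 : ∀ d, ∫ t in (0 : ℝ)..1, (finish h (c, d) - start h (c, d)) /
      (segment (start h (c, d)) (finish h (c, d)) t - w) =
      Complex.log ((finish h (c, d) - w) * v) - Complex.log ((start h (c, d) - w) * v) := by
    refine fun d => integral_segment fun t ht => Or.inl ?_
    have h2 : (segment (start h (c, d)) (finish h (c, d)) t - w) * v =
        ((1 - t : ℝ) : ℂ) * ((start h (c, d) - w) * v) + (t : ℂ) * ((finish h (c, d) - w) * v) := by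
      simp only [segment]; push_cast; ring
    rw [h2, Complex.add_re, Complex.re_ofReal_mul, Complex.re_ofReal_mul]
    have h3 := hv d
    have h4 : 0 < ((finish h (c, d) - w) * v).re := hv (d + 1)
    rcases eq_or_lt_of_le ht.1 with h0 | h0
    · simpa [← h0] using h3
    · have : 0 ≤ 1 - t := by linarith [ht.2]
      positivity
  rw [cellIntegral, Finset.sum_congr rfl fun d _ => h1 d, Finset.sum_sub_distrib, sub_eq_zero]
  exact Equiv.sum_comp (Equiv.addRight (1 : Fin 4))
    fun d => Complex.log ((start h (c, d) - w) * v)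

lemma cellIntegral_of_notMem {h : ℝ} (hh : 0 < h) {w : ℂ} {c : ℤ × ℤ}
    (hw : h < |w.re - 2 * h * c.1| ∨ h < |w.im - 2 * h * c.2|) : cellIntegral h w c = 0 := by
  rcases hw with hw | hw <;> rcases lt_abs.1 hw with hw | hw
  · refine cellIntegral_eq_zero (-1) fun d => ?_
    fin_cases d <;> simp [start] <;> nlinarith
  · refine cellIntegral_eq_zero 1 fun d => ?_
    fin_cases d <;> simp [start] <;> nlinarith
  · refine cellIntegral_eq_zero Complex.I fun d => ?_
    fin_cases d <;> simp [start] <;> nlinarith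
  · refine cellIntegral_eq_zero (-Complex.I) fun d => ?_
    fin_cases d <;> simp [start] <;> nlinarith

/-- Each side contributes the logarithm of a quotient `r d` of consecutive corners relative to `w`.
The quotients have product `1`, so the sum is `2πin`. Each argument lies strictly between `0` and
`π`, so `0 < n < 2`. -/
lemma cellIntegral_of_mem {h : ℝ} (hh : 0 < h) {w : ℂ} {c : ℤ × ℤ}
    (h1 : |w.re - 2 * h * c.1| < h) (h2 : |w.im - 2 * h * c.2| < h) :
    cellIntegral h w c = 2 * Real.pi * Complex.I := by
  rw [abs_lt] at h1 h2
  set r : Fin 4 → ℂ := fun d => (finish h (c, d) - w) / (start h (c, d) - w) with hr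
  -- The point `w` lies strictly to the left of every side.
  have hcross : ∀ d, 0 < ((finish h (c, d) - w) * conj (start h (c, d) - w)).im := by
    intro d
    fin_cases d <;> simp [start, finish] <;> nlinarith
  have hne : ∀ d, start h (c, d) - w ≠ 0 := fun d h0 => by
    have := hcross d
    simp [h0] at this
  have him : ∀ d, 0 < (r d).im := fun d => by
    have h3 : r d = ((Complex.normSq (start h (c, d) - w))⁻¹ : ℝ) *
        ((finish h (c, d) - w) * conj (start h (c, d) - w)) := by
      rw [hr]; simp only; rw [div_eq_mul_inv, Complex.inv_def]; push_cast; ring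
    rw [h3, Complex.im_ofReal_mul]
    exact mul_pos (inv_pos.2 (Complex.normSq_pos.2 (hne d))) (hcross d)
  have hint : ∀ d, ∫ t in (0 : ℝ)..1, (finish h (c, d) - start h (c, d)) /
      (segment (start h (c, d)) (finish h (c, d)) t - w) = Complex.log (r d) := fun d => by
    rw [integral_segment (c := (start h (c, d) - w)⁻¹), mul_inv_cancel₀ (hne d), Complex.log_one,
      sub_zero, ← div_eq_mul_inv]
    intro t ht
    have h4 : (segment (start h (c, d)) (finish h (c, d)) t - w) * (start h (c, d) - w)⁻¹ =
        ((1 - t : ℝ) : ℂ) + (t : ℂ) * r d := by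
      have := hne d
      simp only [segment, hr]; field_simp; push_cast; ring
    rw [h4]
    rcases eq_or_lt_of_le ht.1 with h0 | h0
    · simp [← h0]
    · refine Or.inr (ne_of_gt ?_)
      rw [Complex.add_im, Complex.im_ofReal_mul, Complex.ofReal_im, zero_add]
      exact mul_pos h0 (him d)
  have hsum : cellIntegral h w c = ∑ d, Complex.log (r d) := Finset.sum_congr rfl fun d _ => hint d
  have hr0 : ∀ d, r d ≠ 0 := fun d h0 => by
    have := him d
    simp [h0] at this
  have hexp : Complex.exp (cellIntegral h w c) = 1 := by
    rw [hsum, Complex.exp_sum, Finset.prod_congr rfl fun d _ => Complex.exp_log (hr0 d),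
      Finset.prod_div_distrib]
    have : ∏ d, (finish h (c, d) - w) = ∏ d, (start h (c, d) - w) :=
      Equiv.prod_comp (Equiv.addRight (1 : Fin 4)) fun d => start h (c, d) - w
    rw [this, div_self (Finset.prod_ne_zero_iff.2 fun d _ => hne d)]
  obtain ⟨n, hn⟩ := Complex.exp_eq_one_iff.1 hexp
  have harg : ∀ d, 0 < (r d).arg ∧ (r d).arg < Real.pi := fun d => by
    refine ⟨(Complex.arg_nonneg_iff.2 (him d).le).lt_of_ne' fun h0 => ?_,
      (Complex.arg_le_pi _).lt_of_ne fun h0 => ?_⟩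
    · exact (him d).ne' (Complex.arg_eq_zero_iff.1 h0).2
    · exact (him d).ne' (Complex.arg_eq_pi_iff.1 h0).2
  have him' : (n : ℝ) * (2 * Real.pi) = ∑ d, (r d).arg := by
    have h5 := congrArg Complex.im (hn.symm.trans hsum)
    simpa [Complex.log_im] using h5
  rw [Fin.sum_univ_four] at him'
  have hpi := Real.pi_pos
  have hn1 : n = 1 := by
    have h6 : (0 : ℝ) < n := by nlinarith [harg 0, harg 1, harg 2, harg 3]
    have h7 : (n : ℝ) < 2 := by nlinarith [harg 0, harg 1, harg 2, harg 3]
    have h8 : 0 < n := by exact_mod_cast h6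
    have h9 : n < 2 := by exact_mod_cast h7
    omega
  rw [hn, hn1, Int.cast_one, one_mul]

/-- The closed square with centre `2hc` and side `2h`. -/
def cell (h : ℝ) (c : ℤ × ℤ) : Set ℂ := {z | |z.re - 2 * h * c.1| ≤ h ∧ |z.im - 2 * h * c.2| ≤ h}

lemma segment_mem_cell {h : ℝ} (hh : 0 < h) (e : Edge) {t : ℝ} (ht : t ∈ Icc (0 : ℝ) 1) :
    segment (start h e) (finish h e) t ∈ cell h e.1 := by
  obtain ⟨c, d⟩ := e
  obtain ⟨h0, h1⟩ := ht
  have h2 := mul_nonneg hh.le h0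
  have h3 := mul_nonneg hh.le (sub_nonneg.2 h1)
  simp only [cell, mem_ofPred_eq, abs_le]
  fin_cases d <;> simp [start, finish, segment] <;> refine ⟨⟨?_, ?_⟩, ?_, ?_⟩ <;> nlinarith

lemma segment_mem_cell_neighbour {h : ℝ} (hh : 0 < h) (e : Edge) {t : ℝ}
    (ht : t ∈ Icc (0 : ℝ) 1) : segment (start h e) (finish h e) t ∈ cell h (neighbour e) := by
  have h1 := segment_mem_cell hh (flip e) (t := 1 - t) ⟨by linarith [ht.2], by linarith [ht.1]⟩
  rwa [start_flip, finish_flip, segment_one_sub] at h1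

lemma dist_lt_of_mem_cell {h : ℝ} (hh : 0 < h) {c : ℤ × ℤ} {z w : ℂ} (hz : z ∈ cell h c)
    (hw : w ∈ cell h c) : dist z w < 5 * h := by
  obtain ⟨h1, h2⟩ := hz
  obtain ⟨h3, h4⟩ := hw
  rw [abs_le] at h1 h2 h3 h4
  have h5 : |(z - w).re| ≤ 2 * h := by
    rw [Complex.sub_re, abs_le]; constructor <;> linarith
  have h6 : |(z - w).im| ≤ 2 * h := by
    rw [Complex.sub_im, abs_le]; constructor <;> linarith
  rw [dist_eq_norm]
  linarith [Complex.norm_le_abs_re_add_abs_im (z - w)]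

lemma finite_setOf_cell_inter_nonempty {h : ℝ} (hh : 0 < h) {K : Set ℂ}
    (hK : Bornology.IsBounded K) : {c : ℤ × ℤ | (cell h c ∩ K).Nonempty}.Finite := by
  obtain ⟨M, hM⟩ := hK.exists_norm_le
  obtain ⟨n, hn⟩ := exists_nat_gt ((M + h) / (2 * h))
  rw [div_lt_iff₀ (by positivity)] at hn
  have key : ∀ (x : ℝ) (i : ℤ), |x| ≤ M → |x - 2 * h * i| ≤ h → i ∈ Icc (-(n : ℤ)) n := by
    intro x i h1 h2
    rw [abs_le] at h1 h2
    have h3 : (i : ℝ) < n := by nlinarith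
    have h4 : -(n : ℝ) < i := by nlinarith
    constructor
    · exact_mod_cast h4.le
    · exact_mod_cast h3.le
  refine ((finite_Icc (-(n : ℤ)) n).prod (finite_Icc (-(n : ℤ)) n)).subset ?_
  rintro ⟨i, j⟩ ⟨z, ⟨h1, h2⟩, hz⟩
  exact ⟨key z.re i ((Complex.abs_re_le_norm z).trans (hM z hz)) h1,
    key z.im j ((Complex.abs_im_le_norm z).trans (hM z hz)) h2⟩

lemma exists_int_near {h : ℝ} (hh : 0 < h) (x : ℝ) :
    ∃ i : ℤ, -h ≤ x - 2 * h * i ∧ x - 2 * h * i < h := by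
  refine ⟨⌊x / (2 * h) + 1 / 2⌋, ?_, ?_⟩
  · have h1 := Int.floor_le (x / (2 * h) + 1 / 2)
    have h2 : x = x / (2 * h) * (2 * h) := by field_simp
    nlinarith
  · have h1 := Int.lt_floor_add_one (x / (2 * h) + 1 / 2)
    have h2 : x = x / (2 * h) * (2 * h) := by field_simp
    nlinarith

/-- Each point lies in a square whose interior contains points arbitrarily close to it. -/
lemma exists_cell {h : ℝ} (hh : 0 < h) (w : ℂ) :
    ∃ c, w ∈ cell h c ∧ ∀ p : ℂ → Prop, (∀ᶠ v in 𝓝 w, p v) →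
      ∃ v, p v ∧ |v.re - 2 * h * c.1| < h ∧ |v.im - 2 * h * c.2| < h := by
  obtain ⟨i, hi1, hi2⟩ := exists_int_near hh w.re
  obtain ⟨j, hj1, hj2⟩ := exists_int_near hh w.im
  refine ⟨(i, j), ⟨abs_le.2 ⟨hi1, hi2.le⟩, abs_le.2 ⟨hj1, hj2.le⟩⟩, fun p hp => ?_⟩
  -- With the half-open choice of `i` and `j`, `w` can lie only on the left or lower side of its
  -- square, so a small shift along `1 + i` enters the interior.
  have hc : Tendsto (fun ε : ℝ => w + ε * (1 + Complex.I)) (𝓝[>] 0) (𝓝 w) := by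
    have : Continuous fun ε : ℝ => w + ε * (1 + Complex.I) := by fun_prop
    simpa using (this.tendsto 0).mono_left nhdsWithin_le_nhds
  have h1 : ∀ᶠ ε : ℝ in 𝓝[>] 0, ε < h - (w.re - 2 * h * i) :=
    (eventually_lt_nhds (by linarith)).filter_mono nhdsWithin_le_nhds
  have h2 : ∀ᶠ ε : ℝ in 𝓝[>] 0, ε < h - (w.im - 2 * h * j) :=
    (eventually_lt_nhds (by linarith)).filter_mono nhdsWithin_le_nhds
  obtain ⟨ε, hε, hε1, hε2, hε0⟩ :=
    ((hc.eventually hp).and (h1.and (h2.and self_mem_nhdsWithin))).exists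
  have hε0 : 0 < ε := hε0
  refine ⟨_, hε, ?_, ?_⟩
  · rw [abs_lt]; constructor <;> simp <;> linarith
  · rw [abs_lt]; constructor <;> simp <;> linarith

lemma sum_cellIntegral {h : ℝ} (hh : 0 < h) (Q : Finset (ℤ × ℤ)) {v : ℂ} {c : ℤ × ℤ}
    (h1 : |v.re - 2 * h * c.1| < h) (h2 : |v.im - 2 * h * c.2| < h) :
    ∑ c' ∈ Q, cellIntegral h v c' = if c ∈ Q then 2 * Real.pi * Complex.I else 0 := by
  have far : ∀ (x : ℝ) (i j : ℤ), i ≠ j → |x - 2 * h * i| < h → h < |x - 2 * h * j| := by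
    intro x i j hij h3
    have h4 : (1 : ℝ) ≤ |(i : ℝ) - j| := by
      exact_mod_cast Int.one_le_abs (sub_ne_zero.2 hij)
    have h5 : |2 * h * ((i : ℝ) - j)| ≤ |x - 2 * h * j| + |x - 2 * h * i| := by
      have h6 : 2 * h * ((i : ℝ) - j) = (x - 2 * h * j) - (x - 2 * h * i) := by ring
      rw [h6]
      exact abs_sub _ _
    rw [abs_mul, abs_of_pos (by positivity : 0 < 2 * h)] at h5
    nlinarith
  have h3 : ∀ c' ∈ Q, cellIntegral h v c' = if c = c' then 2 * Real.pi * Complex.I else 0 := by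
    intro c' _
    split_ifs with hc
    · subst hc
      exact cellIntegral_of_mem hh h1 h2
    · refine cellIntegral_of_notMem hh ?_
      by_contra! hcon
      refine hc (Prod.ext ?_ ?_)
      · by_contra h4
        exact absurd (far v.re _ _ h4 h1) hcon.1.not_gt
      · by_contra h4
        exact absurd (far v.im _ _ h4 h2) hcon.2.not_gt
  rw [Finset.sum_congr rfl h3, Finset.sum_ite_eq]

end Grid

open Grid in
/-- A compact set and a closed set that are disjoint are separated by a contour. -/
theorem exists_contour {K₁ K₂ : Set ℂ} (h₁ : IsCompact K₁) (h₂ : IsClosed K₂)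
    (hd : Disjoint K₁ K₂) :
    ∃ Γ : Contour, Disjoint Γ.support (K₁ ∪ K₂) ∧ (∀ z ∈ K₁, Γ.wind z = 1) ∧
      ∀ z ∈ K₂, Γ.wind z = 0 := by
  obtain ⟨δ, hδ, hδd⟩ := hd.exists_thickenings h₁ h₂
  -- Two points of a square are less than `5h = δ` apart, so no square meets both `K₁` and `K₂`.
  set h := δ / 5 with hdef
  have hh : 0 < h := by positivity
  set Q := (finite_setOf_cell_inter_nonempty hh h₁.isBounded).toFinset with hQdef
  have hQ : ∀ c, c ∈ Q ↔ (cell h c ∩ K₁).Nonempty := fun c => by simp [hQdef]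
  have hQ2 : ∀ c ∈ Q, ∀ z ∈ K₂, z ∉ cell h c := fun c hc z hz hzc => by
    obtain ⟨y, hyc, hy⟩ := (hQ c).1 hc
    refine hδd.notMem_of_mem_left (Metric.mem_thickening_iff.2 ⟨y, hy, ?_⟩)
      (Metric.self_subset_thickening hδ _ hz)
    have := dist_lt_of_mem_cell hh hzc hyc
    linarith
  obtain ⟨Γ, hsupp, hwind⟩ := exists_boundary_contour Q h
  have hΓ : Disjoint Γ.support (K₁ ∪ K₂) := by
    rw [disjoint_left]
    intro z hz hzK
    obtain ⟨e, he, t, ht, rfl⟩ := hsupp z hz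
    -- A boundary edge belongs to a square outside `Q`, which misses `K₁`, and to one in `Q`, which
    -- misses `K₂`.
    rw [mem_boundary] at he
    rcases hzK with hz1 | hz2
    · exact he.2 ((hQ _).2 ⟨_, segment_mem_cell_neighbour hh e ht, hz1⟩)
    · exact hQ2 _ he.1 _ hz2 (segment_mem_cell hh e ht)
  -- If `w` lies on a grid line the individual square integrals are not available. Local constancy
  -- of the winding number allows passing to a nearby `v` in an open square.
  have hval : ∀ w ∈ K₁ ∪ K₂, ∃ c, w ∈ cell h c ∧ Γ.wind w = if c ∈ Q then 1 else 0 := by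
    intro w hw
    obtain ⟨c, hc, hcp⟩ := exists_cell hh w
    obtain ⟨v, hv, hv1, hv2⟩ := hcp _ (Contour.eventually_wind_eq (hΓ.notMem_of_mem_right hw))
    refine ⟨c, hc, ?_⟩
    rw [← hv, hwind, sum_boundary Q _ fun e => by
      rw [start_flip, finish_flip, integral_segment_flip]]
    rw [show (∑ c ∈ Q, ∑ d, ∫ t in (0 : ℝ)..1, (finish h (c, d) - start h (c, d)) /
      (segment (start h (c, d)) (finish h (c, d)) t - v)) = ∑ c ∈ Q, cellIntegral h v c from rfl,
      sum_cellIntegral hh Q hv1 hv2]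
    split_ifs
    · exact inv_mul_cancel₀ Complex.two_pi_I_ne_zero
    · exact mul_zero _
  refine ⟨Γ, hΓ, fun z hz => ?_, fun z hz => ?_⟩
  · obtain ⟨c, hc, hcw⟩ := hval z (Or.inl hz)
    rw [hcw, if_pos ((hQ c).2 ⟨z, hc, hz⟩)]
  · obtain ⟨c, hc, hcw⟩ := hval z (Or.inr hz)
    rw [hcw, if_neg fun hcQ => hQ2 c hcQ z hz hc]

/-! ### Real structure, norm estimates and orthogonal expansions in a quaternionic Hilbert space. -/

section RealScalars

variable {H : Type*} [NormedAddCommGroup H] [Module ℍ[ℝ]ᵐᵒᵖ H] [NormedSpace ℝ H]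
  [IsScalarTower ℝ ℍ[ℝ]ᵐᵒᵖ H]

lemma op_coe_smul (r : ℝ) (x : H) : op (r : ℍ[ℝ]) • x = r • x := by
  rw [← smul_one_smul ℍ[ℝ]ᵐᵒᵖ r x]
  congr 1
  rw [← op_one, ← op_smul, Algebra.smul_def, mul_one]
  rfl

end RealScalars

section InnerProduct

variable {H : Type*} [NormedAddCommGroup H] [Module ℍ[ℝ]ᵐᵒᵖ H] [QuaternionicInnerProductSpace H]

open QuaternionicInnerProductSpace (star_inner inner_self)

lemma inner_add_left (x y z : H) :
    inner ℍ[ℝ] (x + y) z = inner ℍ[ℝ] x z + inner ℍ[ℝ] y z := by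
  rw [← star_inner, QuaternionicInnerProductSpace.inner_add_right, star_add, star_inner, star_inner]

lemma inner_smul_left (x y : H) (q : ℍ[ℝ]) :
    inner ℍ[ℝ] (op q • x) y = star q * inner ℍ[ℝ] x y := by
  rw [← star_inner, QuaternionicInnerProductSpace.inner_smul_right, star_mul, star_inner]

lemma norm_op_smul (q : ℍ[ℝ]) (x : H) : ‖op q • x‖ = ‖q‖ * ‖x‖ := by
  have h1 := inner_self (op q • x)
  rw [QuaternionicInnerProductSpace.inner_smul_right, inner_smul_left, inner_self,
    (Quaternion.coe_commute (‖x‖ ^ 2) (star q)).symm.eq, mul_assoc, Quaternion.star_mul_self,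
    ← Quaternion.coe_mul, Quaternion.normSq_eq_norm_mul_self] at h1
  have h2 := Quaternion.coe_injective h1
  rw [← abs_of_nonneg (norm_nonneg (op q • x)), ← abs_of_nonneg (by positivity : 0 ≤ ‖q‖ * ‖x‖),
    ← sq_eq_sq_iff_abs_eq_abs, ← h2]
  ring

lemma inner_sub_right (x y z : H) :
    inner ℍ[ℝ] x (y - z) = inner ℍ[ℝ] x y - inner ℍ[ℝ] x z := by
  rw [eq_sub_iff_add_eq, ← QuaternionicInnerProductSpace.inner_add_right, sub_add_cancel]

lemma IsHilbertBasis.hasSum_norm_sq {N : Set H} (hN : IsHilbertBasis N) (x : H) :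
    HasSum (fun z : N => ‖inner ℍ[ℝ] (z : H) x‖ ^ 2) (‖x‖ ^ 2) := by
  have h1 := (hN.2.2 x x).2
  rw [inner_self] at h1
  refine Quaternion.hasSum_coe.1 (h1.congr_fun fun z => ?_)
  rw [← star_inner x, Quaternion.star_mul_self, Quaternion.normSq_eq_norm_mul_self, sq]

/-- Parseval's identity for `x - y`. Through this lemma, algebraic identities for the left
multiplication are checked on coefficients. -/
lemma IsHilbertBasis.ext_inner {N : Set H} (hN : IsHilbertBasis N) {x y : H}
    (h : ∀ z ∈ N, inner ℍ[ℝ] z x = inner ℍ[ℝ] z y) : x = y := by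
  have h1 := hN.hasSum_norm_sq (x - y)
  have h2 : (fun z : N => ‖inner ℍ[ℝ] (z : H) (x - y)‖ ^ 2) = fun _ => 0 := funext fun z => by
    rw [inner_sub_right, h z z.2, sub_self, norm_zero, zero_pow two_ne_zero]
  rw [h2] at h1
  have h3 := h1.unique hasSum_zero
  rwa [pow_eq_zero_iff two_ne_zero, norm_eq_zero, sub_eq_zero] at h3

variable [NormedSpace ℝ H] [IsScalarTower ℝ ℍ[ℝ]ᵐᵒᵖ H]

/-- The real part of a quaternionic inner product is a real inner product. -/
@[reducible] noncomputable def realInnerProductSpace : InnerProductSpace ℝ H where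
  inner x y := (inner ℍ[ℝ] x y).re
  norm_sq_eq_re_inner x := by
    rw [inner_self, Quaternion.re_coe]
    rfl
  conj_inner_symm x y := by
    rw [← star_inner x y, Quaternion.re_star]
    rfl
  add_left x y z := by simp [inner_add_left]
  smul_left x y r := by
    simp [← op_coe_smul, inner_smul_left]

/-- Real Cauchy–Schwarz is applied after multiplying `y` by the conjugate of `⟪x, y⟫`, which makes
the inner product real and equal to `‖⟪x, y⟫‖²`. -/
lemma norm_inner_le (x y : H) : ‖inner ℍ[ℝ] x y‖ ≤ ‖x‖ * ‖y‖ := by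
  let _ : InnerProductSpace ℝ H := realInnerProductSpace
  have h1 : inner ℝ x (op (star (inner ℍ[ℝ] x y)) • y) ≤
      ‖x‖ * ‖op (star (inner ℍ[ℝ] x y)) • y‖ := real_inner_le_norm _ _
  have h2 : inner ℝ x (op (star (inner ℍ[ℝ] x y)) • y) = ‖inner ℍ[ℝ] x y‖ ^ 2 := by
    change (inner ℍ[ℝ] x _).re = _
    rw [QuaternionicInnerProductSpace.inner_smul_right, Quaternion.self_mul_star,
      Quaternion.re_coe, Quaternion.normSq_eq_norm_mul_self, sq]
  rw [h2, norm_op_smul, norm_star] at h1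
  by_contra! h3
  have h4 : 0 < ‖inner ℍ[ℝ] x y‖ := lt_of_le_of_lt (by positivity) h3
  nlinarith

/-- The continuous real linear map `y ↦ ⟪x, y⟫`. -/
noncomputable def innerCLM (x : H) : H →L[ℝ] ℍ[ℝ] :=
  LinearMap.mkContinuous
    { toFun := fun y => inner ℍ[ℝ] x y
      map_add' := QuaternionicInnerProductSpace.inner_add_right x
      map_smul' := fun r y => by
        rw [← op_coe_smul, QuaternionicInnerProductSpace.inner_smul_right, Quaternion.mul_coe_eq_smul]
        rfl }
    ‖x‖ (norm_inner_le x)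

/-- Right multiplication by a quaternion, as a continuous real linear map. -/
noncomputable def rightMulCLM (q : ℍ[ℝ]) : H →L[ℝ] H :=
  LinearMap.mkContinuous
    { toFun := fun x => op q • x
      map_add' := smul_add _
      map_smul' := fun r x => by
        rw [← op_coe_smul, ← op_coe_smul, smul_smul, smul_smul, ← op_mul, ← op_mul,
          (Quaternion.coe_commute r q).eq]
        rfl }
    ‖q‖ fun x => (norm_op_smul q x).le

@[simp] lemma rightMulCLM_apply (q : ℍ[ℝ]) (x : H) : rightMulCLM q x = op q • x := rfl

@[simp] lemma innerCLM_apply (x y : H) : innerCLM x y = inner ℍ[ℝ] x y := rfl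

/-! ### The left multiplication induced by a Hilbert basis -/

namespace IsHilbertBasis

variable {N : Set H}

variable [CompleteSpace H]

/-- The maps `q ↦ zq` are isometric embeddings of `ℍ` with mutually orthogonal ranges for the real
inner product, so square summability suffices. -/
lemma summable_smul (hN : IsHilbertBasis N) {c : N → ℍ[ℝ]} (hc : Summable fun z => ‖c z‖ ^ 2) :
    Summable fun z : N => op (c z) • (z : H) := by
  let _ : InnerProductSpace ℝ H := realInnerProductSpace
  have hnorm : ∀ z : N, ‖(z : H)‖ = 1 := fun z => by
    have h1 := hN.1 z z.2
    rw [inner_self, ← Quaternion.coe_one] at h1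
    have h2 := Quaternion.coe_injective h1
    exact (pow_eq_one_iff_of_nonneg (norm_nonneg _) two_ne_zero).1 h2
  let V : N → ℍ[ℝ] →ₗᵢ[ℝ] H := fun z =>
    { toFun := fun q => op q • (z : H)
      map_add' := fun p q => by rw [op_add, add_smul]
      map_smul' := fun r q => by rw [op_smul, smul_assoc]; rfl
      norm_map' := fun q => by
        change ‖op q • (z : H)‖ = ‖q‖
        rw [norm_op_smul, hnorm, mul_one] }
  have hV : OrthogonalFamily ℝ (fun _ : N => ℍ[ℝ]) V := fun z w hzw p q => by
    change (inner ℍ[ℝ] (op p • (z : H)) (op q • (w : H))).re = 0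
    rw [inner_smul_left, QuaternionicInnerProductSpace.inner_smul_right,
      hN.2.1 z z.2 w w.2 fun h => hzw (Subtype.ext h)]
    simp
  exact (hV.summable_iff_norm_sq_summable c).2 hc

/-- The continuous functional `⟪z, ·⟫` passes through the defining series, and orthonormality leaves
one term. -/
lemma inner_leftMul (hN : IsHilbertBasis N) (q : ℍ[ℝ]) (x : H) {z : H} (hz : z ∈ N) :
    inner ℍ[ℝ] z (leftMul N q x) = q * inner ℍ[ℝ] z x := by
  have h1 : Summable fun w : N => op (q * inner ℍ[ℝ] (w : H) x) • (w : H) := by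
    refine hN.summable_smul ?_
    simp only [norm_mul, mul_pow]
    exact (hN.hasSum_norm_sq x).summable.mul_left _
  have h2 := h1.hasSum.mapL (innerCLM z)
  refine h2.unique ?_
  have h3 := hasSum_single (f := fun w : N => innerCLM z (op (q * inner ℍ[ℝ] (w : H) x) • (w : H)))
    ⟨z, hz⟩ fun w hw => by
      rw [innerCLM_apply, QuaternionicInnerProductSpace.inner_smul_right,
        hN.2.1 z hz w w.2 fun h => hw (Subtype.ext h.symm), zero_mul]
  rwa [innerCLM_apply, QuaternionicInnerProductSpace.inner_smul_right, hN.1 z hz, one_mul] at h3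

lemma norm_leftMul (hN : IsHilbertBasis N) (q : ℍ[ℝ]) (x : H) :
    ‖leftMul N q x‖ = ‖q‖ * ‖x‖ := by
  have h1 := hN.hasSum_norm_sq (leftMul N q x)
  simp only [fun z : N => hN.inner_leftMul q x z.2, norm_mul, mul_pow] at h1
  have h2 := h1.unique ((hN.hasSum_norm_sq x).mul_left _)
  rwa [← mul_pow, sq_eq_sq₀ (norm_nonneg _) (by positivity)] at h2

lemma leftMul_leftMul (hN : IsHilbertBasis N) (p q : ℍ[ℝ]) (x : H) :
    leftMul N p (leftMul N q x) = leftMul N (p * q) x :=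
  hN.ext_inner fun z hz => by simp only [hN.inner_leftMul _ _ hz, mul_assoc]

lemma add_leftMul (hN : IsHilbertBasis N) (p q : ℍ[ℝ]) (x : H) :
    leftMul N (p + q) x = leftMul N p x + leftMul N q x :=
  hN.ext_inner fun z hz => by
    simp only [hN.inner_leftMul _ _ hz, QuaternionicInnerProductSpace.inner_add_right, add_mul]

lemma leftMul_add (hN : IsHilbertBasis N) (q : ℍ[ℝ]) (x y : H) :
    leftMul N q (x + y) = leftMul N q x + leftMul N q y :=
  hN.ext_inner fun z hz => by
    simp only [hN.inner_leftMul _ _ hz, QuaternionicInnerProductSpace.inner_add_right, mul_add]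

lemma leftMul_coe (hN : IsHilbertBasis N) (r : ℝ) (x : H) : leftMul N (r : ℍ[ℝ]) x = r • x :=
  hN.ext_inner fun z hz => by
    rw [hN.inner_leftMul _ _ hz, ← op_coe_smul, QuaternionicInnerProductSpace.inner_smul_right,
      (Quaternion.coe_commute r _).eq]

lemma leftMul_smul (hN : IsHilbertBasis N) (q : ℍ[ℝ]) (r : ℝ) (x : H) :
    leftMul N q (r • x) = r • leftMul N q x := by
  rw [← hN.leftMul_coe, ← hN.leftMul_coe, hN.leftMul_leftMul, hN.leftMul_leftMul,
    (Quaternion.coe_commute r q).eq]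

/-- Left multiplication by a quaternion, as a continuous real linear map. -/
noncomputable def leftMulCLM (hN : IsHilbertBasis N) (q : ℍ[ℝ]) : H →L[ℝ] H :=
  LinearMap.mkContinuous
    { toFun := leftMul N q
      map_add' := hN.leftMul_add q
      map_smul' := hN.leftMul_smul q }
    ‖q‖ fun x => (hN.norm_leftMul q x).le

@[simp] lemma leftMulCLM_apply (hN : IsHilbertBasis N) (q : ℍ[ℝ]) (x : H) :
    hN.leftMulCLM q x = leftMul N q x := rfl

end IsHilbertBasis

end InnerProduct

/-! ### The underlying complex Banach space -/

lemma norm_coeComplex (z : ℂ) : ‖(z : ℍ[ℝ])‖ = ‖z‖ := by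
  have h : ‖(z : ℍ[ℝ])‖ * ‖(z : ℍ[ℝ])‖ = ‖z‖ * ‖z‖ := by
    rw [← Quaternion.normSq_eq_norm_mul_self, Quaternion.normSq_def', ← sq ‖z‖, Complex.sq_norm,
      Complex.normSq_apply]
    simp
    ring
  exact (mul_self_inj (norm_nonneg _) (norm_nonneg _)).1 h

/-- The real vector space `H` with the complex structure given by right multiplication with the
quaternions `α + iβ`. -/
def SliceSpace (H : Type*) : Type _ := H

namespace SliceSpace

variable {H : Type*} [NormedAddCommGroup H] [Module ℍ[ℝ]ᵐᵒᵖ H]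

noncomputable instance : NormedAddCommGroup (SliceSpace H) := inferInstanceAs (NormedAddCommGroup H)

noncomputable instance : Module ℍ[ℝ]ᵐᵒᵖ (SliceSpace H) := inferInstanceAs (Module ℍ[ℝ]ᵐᵒᵖ H)

instance [CompleteSpace H] : CompleteSpace (SliceSpace H) := inferInstanceAs (CompleteSpace H)

noncomputable instance : Module ℂ (SliceSpace H) :=
  Module.compHom _ ((Quaternion.ofComplex : ℂ →+* ℍ[ℝ]).toOpposite fun x y => by
    rw [Commute, SemiconjBy, ← map_mul, mul_comm, map_mul])

lemma smul_def (z : ℂ) (x : SliceSpace H) : z • x = op (z : ℍ[ℝ]) • x := rfl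

/-- Right `ℍ`-linear operators are complex linear. -/
noncomputable def toSlice : (H →L[ℍ[ℝ]ᵐᵒᵖ] H) →+* (SliceSpace H →L[ℂ] SliceSpace H) where
  toFun T :=
    { toFun := fun x => T x
      map_add' := T.map_add
      map_smul' := fun z x => T.map_smul (op (z : ℍ[ℝ])) x
      cont := T.continuous }
  map_one' := rfl
  map_mul' _ _ := rfl
  map_zero' := rfl
  map_add' _ _ := rfl

lemma toSlice_injective : Function.Injective (toSlice (H := H)) := fun _ _ h =>
  ContinuousLinearMap.ext fun x => congrArg (fun A => A x) h

/-- The imaginary unit `j`. -/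
def unitJ : ℍ[ℝ] := ⟨0, 0, 1, 0⟩

@[simp] lemma re_unitJ : unitJ.re = 0 := rfl
@[simp] lemma imI_unitJ : unitJ.imI = 0 := rfl
@[simp] lemma imJ_unitJ : unitJ.imJ = 1 := rfl
@[simp] lemma imK_unitJ : unitJ.imK = 0 := rfl

lemma unitJ_mul_self : unitJ * unitJ = -1 := by
  ext <;> simp

lemma norm_unitJ : ‖unitJ‖ = 1 := by
  have h : ‖unitJ‖ * ‖unitJ‖ = 1 := by
    rw [← Quaternion.normSq_eq_norm_mul_self, Quaternion.normSq_def']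
    simp
  nlinarith [norm_nonneg unitJ]

lemma coe_mul_unitJ (z : ℂ) : (z : ℍ[ℝ]) * unitJ = unitJ * (conj z : ℂ) := by
  ext <;> simp

/-- Right multiplication by `j` is conjugate linear; with its square `-1` it is the quaternionic
structure on the complex space. -/
lemma smul_unitJ_smul (z : ℂ) (x : SliceSpace H) :
    z • op unitJ • x = op unitJ • (conj z) • x := by
  rw [smul_def, smul_def, smul_smul, smul_smul, ← op_mul, ← op_mul, coe_mul_unitJ,
    Complex.conj_conj]

lemma unitJ_smul_unitJ_smul (x : SliceSpace H) : op unitJ • op unitJ • x = -x := by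
  rw [smul_smul, ← op_mul, unitJ_mul_self, op_neg, op_one, neg_smul, one_smul]

variable [QuaternionicInnerProductSpace H]

noncomputable instance : NormedSpace ℂ (SliceSpace H) where
  norm_smul_le z x := by
    have h := norm_op_smul (H := H) (z : ℍ[ℝ]) x
    rw [norm_coeComplex] at h
    exact h.le

lemma norm_unitJ_smul (x : SliceSpace H) : ‖op unitJ • x‖ = ‖x‖ := by
  have h := norm_op_smul (H := H) unitJ x
  rwa [norm_unitJ, one_mul] at h

/-- Conjugation of complex linear operators by right multiplication with `j`. -/
noncomputable def conjJ :
    (SliceSpace H →L[ℂ] SliceSpace H) →+* (SliceSpace H →L[ℂ] SliceSpace H) where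
  toFun S := LinearMap.mkContinuous
    { toFun := fun x => -(op unitJ • S (op unitJ • x))
      map_add' := fun x y => by rw [smul_add, map_add, smul_add, neg_add]
      map_smul' := fun z x => by
        have h := smul_unitJ_smul (conj z) x
        rw [Complex.conj_conj] at h
        rw [← h, map_smul, RingHom.id_apply, smul_neg, smul_unitJ_smul] }
    ‖S‖ fun x => by
      change ‖-(op unitJ • S (op unitJ • x))‖ ≤ _
      rw [norm_neg, norm_unitJ_smul]
      exact (S.le_opNorm _).trans_eq (by rw [norm_unitJ_smul])
  map_one' := ContinuousLinearMap.ext fun x => by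
    change -(op unitJ • op unitJ • x) = x
    rw [unitJ_smul_unitJ_smul, neg_neg]
  map_mul' S S' := ContinuousLinearMap.ext fun x => by
    change -(op unitJ • S (S' (op unitJ • x))) =
      -(op unitJ • S (op unitJ • -(op unitJ • S' (op unitJ • x))))
    rw [smul_neg, unitJ_smul_unitJ_smul, neg_neg]
  map_zero' := ContinuousLinearMap.ext fun x => by
    change -(op unitJ • (0 : SliceSpace H)) = 0
    rw [smul_zero, neg_zero]
  map_add' S S' := ContinuousLinearMap.ext fun x => by
    change -(op unitJ • (S (op unitJ • x) + S' (op unitJ • x))) =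
      -(op unitJ • S (op unitJ • x)) + -(op unitJ • S' (op unitJ • x))
    rw [smul_add, neg_add]

lemma conjJ_apply (S : SliceSpace H →L[ℂ] SliceSpace H) (x : SliceSpace H) :
    conjJ S x = -(op unitJ • S (op unitJ • x)) := rfl

lemma continuous_conjJ : Continuous (conjJ (H := H)) :=
  AddMonoidHomClass.continuous_of_bound conjJ 1 fun S => by
    rw [one_mul]
    refine ContinuousLinearMap.opNorm_le_bound _ (norm_nonneg S) fun x => ?_
    rw [conjJ_apply, norm_neg, norm_unitJ_smul]
    exact (S.le_opNorm _).trans_eq (by rw [norm_unitJ_smul])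

lemma conjJ_smul (z : ℂ) (S : SliceSpace H →L[ℂ] SliceSpace H) :
    conjJ (z • S) = conj z • conjJ S := ContinuousLinearMap.ext fun x => by
  have h := smul_unitJ_smul (conj z) (S (op unitJ • x))
  rw [Complex.conj_conj] at h
  change -(op unitJ • z • S (op unitJ • x)) = conj z • -(op unitJ • S (op unitJ • x))
  rw [← h, smul_neg]

lemma conjJ_toSlice (T : H →L[ℍ[ℝ]ᵐᵒᵖ] H) : conjJ (toSlice T) = toSlice T :=
  ContinuousLinearMap.ext fun x => by
    have h : toSlice T (op unitJ • x) = op unitJ • toSlice T x := T.map_smul (op unitJ) x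
    rw [conjJ_apply, h, unitJ_smul_unitJ_smul, neg_neg]

/-- The operators that are invariant under conjugation by `j` are the `ℍ`-linear ones. -/
lemma exists_toSlice_eq {S : SliceSpace H →L[ℂ] SliceSpace H} (hS : conjJ S = S) :
    ∃ T, toSlice T = S := by
  have hj : ∀ x, S (op unitJ • x) = op unitJ • S x := fun x => by
    have h : conjJ S x = S x := by rw [hS]
    rw [← h, conjJ_apply, smul_neg, unitJ_smul_unitJ_smul, neg_neg]
  have hq : ∀ (q : ℍ[ℝ]) (x : SliceSpace H), S (op q • x) = op q • S x := fun q x => by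
    -- Every quaternion is `a + bj` with `a, b ∈ ℂ_i`, so complex linearity and commutation with `j`
    -- suffice.
    have h : q = ((⟨q.re, q.imI⟩ : ℂ) : ℍ[ℝ]) + ((⟨q.imJ, q.imK⟩ : ℂ) : ℍ[ℝ]) * unitJ := by
      ext <;> simp
    rw [h, op_add, op_mul, add_smul, add_smul, mul_smul, mul_smul, map_add, hj, ← smul_def,
      ← smul_def, map_smul, map_smul, smul_def, smul_def]
  exact ⟨{ toFun := fun x => S x
           map_add' := S.map_add
           map_smul' := fun q x => hq (unop q) x
           cont := S.continuous }, rfl⟩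

lemma conjJ_algebraMap_sub (T : H →L[ℍ[ℝ]ᵐᵒᵖ] H) (z : ℂ) :
    conjJ (algebraMap ℂ (SliceSpace H →L[ℂ] SliceSpace H) z - toSlice T) =
      algebraMap ℂ (SliceSpace H →L[ℂ] SliceSpace H) (conj z) - toSlice T := by
  rw [map_sub, conjJ_toSlice, Algebra.algebraMap_eq_smul_one, conjJ_smul, map_one,
    Algebra.algebraMap_eq_smul_one]

lemma conj_notMem_spectrum {T : H →L[ℍ[ℝ]ᵐᵒᵖ] H} {z : ℂ}
    (hz : z ∉ spectrum ℂ (toSlice T)) :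
    conj z ∉ spectrum ℂ (toSlice T) := by
  refine not_not.2 (show IsUnit (algebraMap ℂ (SliceSpace H →L[ℂ] SliceSpace H) (conj z) - toSlice T) from ?_)
  rw [← conjJ_algebraMap_sub]
  exact (not_not.1 hz : IsUnit (algebraMap ℂ _ z - toSlice T)).map conjJ

variable [NormedSpace ℝ H] [IsScalarTower ℝ ℍ[ℝ]ᵐᵒᵖ H]

/-- The identity of `H`, as a real linear map from `SliceSpace H`. -/
noncomputable def toReal : SliceSpace H →L[ℝ] H where
  toFun x := x
  map_add' _ _ := rfl
  map_smul' r x := by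
    change op (((r : ℂ) : ℍ[ℝ])) • (show H from x) = r • (show H from x)
    rw [Quaternion.coeComplex_coe]
    exact op_coe_smul r _
  cont := continuous_id

lemma toReal_smul (z : ℂ) (x : SliceSpace H) :
    toReal (z • x) = z.re • toReal x + z.im • op (Complex.I : ℍ[ℝ]) • toReal x := by
  have h1 : z • x = z.re • x + z.im • Complex.I • x := by
    rw [← Complex.coe_smul, ← Complex.coe_smul, smul_smul, ← add_smul, Complex.re_add_im]
  rw [h1, map_add, map_smul, map_smul]
  rfl

lemma toReal_toSlice (T : H →L[ℍ[ℝ]ᵐᵒᵖ] H) (x : SliceSpace H) :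
    toReal (toSlice T x) = T (toReal x) := rfl

lemma toSlice_real_smul (r : ℝ) (T : H →L[ℍ[ℝ]ᵐᵒᵖ] H) : toSlice (r • T) = (r : ℂ) • toSlice T :=
  ContinuousLinearMap.ext fun x =>
    (toReal.map_smul r (toSlice T x)).symm

end SliceSpace

/-! ### The spherical spectrum and the complex spectrum -/

section Spectrum

lemma mul_mul_eq_of_mul_eq_one {R : Type*} [Monoid R] {a b : R} (h : a * b = 1) (c : R) :
    a * (b * c) = c := by
  rw [← mul_assoc, h, one_mul]

lemma mul_mul_mul_eq_one {R : Type*} [Monoid R] {a b a' b' : R} (h₁ : b * b' = 1)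
    (h₂ : a * a' = 1) : a * b * (b' * a') = 1 := by
  rw [mul_assoc, mul_mul_eq_of_mul_eq_one h₁, h₂]

lemma slicePt_re {m : ℍ[ℝ]} (hm : m ∈ imaginaryUnits) (z : ℂ) : (slicePt m z).re = z.re := by
  have h : m.re = 0 := by
    have := congrArg (·.re) hm.1
    simp at this
    linarith
  simp [slicePt, h]

lemma imaginaryUnit_mul_self {m : ℍ[ℝ]} (hm : m ∈ imaginaryUnits) : m * m = -1 := by
  have h := Quaternion.self_mul_star m
  rw [hm.1, Quaternion.normSq_eq_norm_mul_self, hm.2, mul_neg] at h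
  rw [← neg_eq_iff_eq_neg, h]
  simp

lemma star_slicePt {m : ℍ[ℝ]} (hm : m ∈ imaginaryUnits) (z : ℂ) :
    star (slicePt m z) = (z.re : ℍ[ℝ]) - m * (z.im : ℍ[ℝ]) := by
  rw [slicePt, star_add, star_mul, hm.1, Quaternion.star_coe, Quaternion.star_coe, mul_neg,
    (Quaternion.coe_commute z.im m).eq, sub_eq_add_neg]

lemma norm_slicePt_sq {m : ℍ[ℝ]} (hm : m ∈ imaginaryUnits) (z : ℂ) :
    ‖slicePt m z‖ ^ 2 = z.re ^ 2 + z.im ^ 2 := by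
  have h1 : slicePt m z * star (slicePt m z) = ((z.re ^ 2 + z.im ^ 2 : ℝ) : ℍ[ℝ]) := by
    have h2 := (Quaternion.coe_commute z.im m).eq
    have h3 := (Quaternion.coe_commute z.re m).eq
    have h4 := (Quaternion.coe_commute z.re (z.im : ℍ[ℝ])).eq
    rw [star_slicePt hm, slicePt]
    calc ((z.re : ℍ[ℝ]) + m * z.im) * (z.re - m * z.im)
        = (z.re : ℍ[ℝ]) * z.re + m * (z.im * z.re) - (z.re * m) * z.im
          - m * (z.im * m) * z.im := by noncomm_ring
      _ = (z.re : ℍ[ℝ]) * z.re + m * (z.im * z.re) - m * (z.re * z.im)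
          - m * m * (z.im * z.im) := by rw [h2, h3]; noncomm_ring
      _ = _ := by
        rw [imaginaryUnit_mul_self hm, h4]
        push_cast
        noncomm_ring
  rw [Quaternion.self_mul_star] at h1
  rw [sq, ← Quaternion.normSq_eq_norm_mul_self]
  exact Quaternion.coe_injective h1

variable {H : Type*} [NormedAddCommGroup H] [NormedSpace ℝ H] [Module ℍ[ℝ]ᵐᵒᵖ H]
  [IsScalarTower ℝ ℍ[ℝ]ᵐᵒᵖ H] [QuaternionicInnerProductSpace H]

open SliceSpace

variable {m : ℍ[ℝ]} (hm : m ∈ imaginaryUnits) (T : H →L[ℍ[ℝ]ᵐᵒᵖ] H) (z : ℂ)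

local notation "𝓑" => (SliceSpace H →L[ℂ] SliceSpace H)

-- The coefficients are symmetric in `z` and its conjugate: `2 re(s) = z + z̄` and `|s|² = z z̄`.
-- They do not depend on `m`.
include hm in
lemma toSlice_Delta : toSlice (Delta (slicePt m z) T) =
    (algebraMap ℂ 𝓑 z - toSlice T) * (algebraMap ℂ 𝓑 (conj z) - toSlice T) := by
  rw [Delta, slicePt_re hm, norm_slicePt_sq hm, map_add, map_sub, map_pow, toSlice_real_smul,
    toSlice_real_smul, map_one, sub_mul, mul_sub, mul_sub, ← map_mul, Complex.mul_conj,
    Complex.normSq_apply, Algebra.algebraMap_eq_smul_one, Algebra.algebraMap_eq_smul_one,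
    Algebra.algebraMap_eq_smul_one, smul_one_mul, mul_smul_one, sq (toSlice T)]
  have h : ((2 * z.re : ℝ) : ℂ) = z + conj z := by
    rw [Complex.add_conj]
  rw [h, add_smul, sq, sq]
  abel

-- The two factors of `Δ_s(T)` commute and are exchanged by conjugation with `j`, so their product
-- is invertible exactly when `z - T` is, over the complex operators. The point is to find the
-- inverse among the `ℍ`-linear operators.
include hm in
lemma mem_spectrum_toSlice :
    z ∈ spectrum ℂ (toSlice T) ↔ slicePt m z ∈ sphericalSpectrum T := by
  refine not_congr (Iff.trans ⟨fun h => ?_, fun h => ?_⟩ Iff.rfl)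
  · change IsUnit (Delta (slicePt m z) T)
    have h1 : IsUnit (algebraMap ℂ 𝓑 (conj z) - toSlice T) := by
      rw [← conjJ_algebraMap_sub]
      exact h.map conjJ
    have h2 := IsUnit.mul (show IsUnit (algebraMap ℂ 𝓑 z - toSlice T) from h) h1
    rw [← toSlice_Delta hm] at h2
    obtain ⟨u, hu⟩ := h2
    -- The inverse of an element fixed by `conjJ` is fixed too, hence is `ℍ`-linear.
    have h3 : conjJ ((u⁻¹ : (𝓑)ˣ) : 𝓑) = ((u⁻¹ : (𝓑)ˣ) : 𝓑) := by
      have h4 : Units.map (conjJ (H := H)).toMonoidHom u = u := Units.ext (by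
        change conjJ (u : 𝓑) = u
        rw [hu, conjJ_toSlice])
      have h5 := congrArg (fun v : (𝓑)ˣ => ((v⁻¹ : (𝓑)ˣ) : 𝓑)) h4
      rwa [← map_inv] at h5
    obtain ⟨D, hD⟩ := exists_toSlice_eq h3
    have h6 : Delta (slicePt m z) T * D = 1 := toSlice_injective (by
      rw [map_mul, map_one, hD, ← hu, Units.mul_inv])
    have h7 : D * Delta (slicePt m z) T = 1 := toSlice_injective (by
      rw [map_mul, map_one, hD, ← hu, Units.inv_mul])
    exact ⟨⟨_, D, h6, h7⟩, rfl⟩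
  · have h1 := (show IsUnit (Delta (slicePt m z) T) from h).map (toSlice (H := H))
    rw [toSlice_Delta hm] at h1
    have h2 : Commute (algebraMap ℂ 𝓑 z - toSlice T) (algebraMap ℂ 𝓑 (conj z) - toSlice T) :=
      (Algebra.commute_algebraMap_left z _).sub_left
        ((Algebra.commute_algebraMap_right _ _).sub_right (Commute.refl _))
    exact (h2.isUnit_mul_iff.1 h1).1

variable {T z}

include hm in
lemma toSlice_inverse_Delta (hz : z ∉ spectrum ℂ (toSlice T)) :
    toSlice (Ring.inverse (Delta (slicePt m z) T)) =
      resolvent (toSlice T) (conj z) * resolvent (toSlice T) z := by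
  have h1 : IsUnit (Delta (slicePt m z) T) :=
    not_not.1 fun h => hz ((mem_spectrum_toSlice hm T z).2 h)
  have h2 : toSlice (Ring.inverse (Delta (slicePt m z) T)) *
      ((algebraMap ℂ 𝓑 z - toSlice T) * (algebraMap ℂ 𝓑 (conj z) - toSlice T)) = 1 := by
    rw [← toSlice_Delta hm, ← map_mul, Ring.inverse_mul_cancel _ h1, map_one]
  refine left_inv_eq_right_inv h2 (mul_mul_mul_eq_one ?_ ?_)
  · exact sub_mul_resolvent (conj_notMem_spectrum hz)
  · exact sub_mul_resolvent hz

include hm in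
lemma resolvent_eq (hz : z ∉ spectrum ℂ (toSlice T)) :
    resolvent (toSlice T) z = (algebraMap ℂ 𝓑 (conj z) - toSlice T) *
      toSlice (Ring.inverse (Delta (slicePt m z) T)) := by
  rw [toSlice_inverse_Delta hm hz]
  refine (mul_mul_eq_of_mul_eq_one ?_ _).symm
  exact sub_mul_resolvent (conj_notMem_spectrum hz)

end Spectrum

/-! ### Axially symmetric sets -/

/-- Real part and norm of the quaternion determine the complex number up to conjugation. -/
lemma eq_or_eq_conj_of_slicePt_eq {m n : ℍ[ℝ]} (hm : m ∈ imaginaryUnits) (hn : n ∈ imaginaryUnits)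
    {z w : ℂ} (h : slicePt m z = slicePt n w) : w = z ∨ w = conj z := by
  have h1 : z.re = w.re := by rw [← slicePt_re hm, h, slicePt_re hn]
  have h2 : z.re ^ 2 + z.im ^ 2 = w.re ^ 2 + w.im ^ 2 := by
    rw [← norm_slicePt_sq hm, h, norm_slicePt_sq hn]
  rw [h1, add_right_inj, sq_eq_sq_iff_eq_or_eq_neg] at h2
  rcases h2 with h2 | h2
  · exact Or.inl (Complex.ext h1.symm h2.symm)
  · exact Or.inr (Complex.ext h1.symm (by rw [Complex.conj_im, h2, neg_neg]))

lemma slicePt_mem_circularization {S : Set ℂ} (hS : ∀ z ∈ S, conj z ∈ S) {m : ℍ[ℝ]}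
    (hm : m ∈ imaginaryUnits) {z : ℂ} : slicePt m z ∈ circularization S ↔ z ∈ S := by
  refine ⟨?_, fun h => ⟨z, h, m, hm, rfl⟩⟩
  rintro ⟨w, hw, n, hn, h⟩
  rcases eq_or_eq_conj_of_slicePt_eq hm hn h with rfl | rfl
  · exact hw
  · simpa using hS _ hw

lemma continuous_slicePt (m : ℍ[ℝ]) : Continuous (slicePt m) :=
  (Quaternion.continuous_coe.comp Complex.continuous_re).add
    (continuous_const.mul (Quaternion.continuous_coe.comp Complex.continuous_im))

lemma exists_imaginaryUnit : imaginaryUnits.Nonempty := by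
  refine ⟨SliceSpace.unitJ, ?_, SliceSpace.norm_unitJ⟩
  ext <;> simp

lemma isClosed_of_circularization {S : Set ℂ} (hS : ∀ z ∈ S, conj z ∈ S)
    (h : IsClosed (circularization S)) : IsClosed S := by
  obtain ⟨m, hm⟩ := exists_imaginaryUnit
  have h1 : S = slicePt m ⁻¹' circularization S :=
    Set.ext fun z => (slicePt_mem_circularization hS hm).symm
  rw [h1]
  exact h.preimage (continuous_slicePt m)

lemma Contour.separates_circularization_iff {Γ : Contour} {m : ℍ[ℝ]} (hm : m ∈ imaginaryUnits)
    {S₁ S₂ : Set ℂ} (h₁ : ∀ z ∈ S₁, conj z ∈ S₁) (h₂ : ∀ z ∈ S₂, conj z ∈ S₂) :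
    Γ.Separates m (circularization S₁) (circularization S₂) ↔
      Disjoint Γ.support (S₁ ∪ S₂) ∧ (∀ z ∈ S₁, Γ.wind z = 1) ∧ ∀ z ∈ S₂, Γ.wind z = 0 := by
  simp only [Separates, mem_union, slicePt_mem_circularization h₁ hm,
    slicePt_mem_circularization h₂ hm]
  refine and_congr_left fun _ => ⟨fun h => disjoint_left.2 fun z hz => ?_, fun h k t ht => ?_⟩
  · obtain ⟨k, t, ht, rfl⟩ := mem_iUnion.1 hz
    exact h k t ht
  · exact disjoint_left.1 h (Γ.arc_mem_support k ht)

/-! ### The Riesz integral -/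

lemma Contour.intervalIntegrable_clm_smul {E : Type*} [NormedAddCommGroup E] [NormedSpace ℝ E]
    {Γ : Contour} (L : ℂ →L[ℝ] ℝ) {g : ℂ → E} (k : Fin Γ.card)
    (hg : ContinuousOn g Γ.support) :
    IntervalIntegrable (fun t => L (deriv (Γ.arc k) t) • g (Γ.arc k t)) volume 0 1 :=
  Γ.intervalIntegrable_of_continuousOn_mul k
    ((ContinuousLinearMap.lsmul ℝ ℝ : ℝ →L[ℝ] E →L[ℝ] E).comp L)
    (hg.comp (Γ.continuousOn_arc k) fun _ ht => Γ.arc_mem_support k ht) fun _ _ => rfl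

section Riesz

variable {H : Type*} [NormedAddCommGroup H] [NormedSpace ℝ H] [Module ℍ[ℝ]ᵐᵒᵖ H]
  [IsScalarTower ℝ ℍ[ℝ]ᵐᵒᵖ H] [QuaternionicInnerProductSpace H]

open SliceSpace

variable (T : H →L[ℍ[ℝ]ᵐᵒᵖ] H) (m : ℍ[ℝ])

/-- The vector `(T - re s) Δ_s(T)⁻¹ x` for `s` in the slice `ℂ_m`. -/
noncomputable def resolventRe (z : ℂ) (x : H) : H :=
  T (Ring.inverse (Delta (slicePt m z) T) x) - z.re • Ring.inverse (Delta (slicePt m z) T) x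

/-- The vector `im s Δ_s(T)⁻¹ x` for `s` in the slice `ℂ_m`. -/
noncomputable def resolventIm (z : ℂ) (x : H) : H :=
  z.im • Ring.inverse (Delta (slicePt m z) T) x

lemma op_smul_real_smul (q : ℍ[ℝ]) (r : ℝ) (x : H) : op q • r • x = r • op q • x :=
  (rightMulCLM q).map_smul r x

lemma resolventRe_op_smul (z : ℂ) (q : ℍ[ℝ]) (x : H) :
    resolventRe T m z (op q • x) = op q • resolventRe T m z x := by
  simp only [resolventRe, map_smul, smul_sub, op_smul_real_smul]

lemma resolventIm_op_smul (z : ℂ) (q : ℍ[ℝ]) (x : H) :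
    resolventIm T m z (op q • x) = op q • resolventIm T m z x := by
  simp only [resolventIm, map_smul, op_smul_real_smul]

variable {m} (hm : m ∈ imaginaryUnits)

-- In `(z̄ - T) Δ_s(T)⁻¹` only the imaginary part of `z̄` involves `i`. Both components are
-- expressed by `T`, `Δ_s(T)⁻¹` and real scalars, so they commute with right multiplication by
-- quaternions.
include hm in
lemma toReal_resolvent {z : ℂ} (hz : z ∉ spectrum ℂ (toSlice T)) (x : SliceSpace H) :
    toReal (resolvent (toSlice T) z x) = -resolventRe T m z (toReal x) -
      op (Complex.I : ℍ[ℝ]) • resolventIm T m z (toReal x) := by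
  rw [resolvent_eq hm hz, mul_apply_eq_comp, sub_apply, map_sub,
    Algebra.algebraMap_eq_smul_one, smul_apply, one_apply_eq_self,
    toReal_smul, resolventRe, resolventIm, op_smul_real_smul, Complex.conj_re, Complex.conj_im]
  simp only [toReal_toSlice]
  generalize op (Complex.I : ℍ[ℝ]) • Ring.inverse (Delta (slicePt m z) T) (toReal x) = y
  module

lemma op_I_smul_op_unitJ_smul (x : SliceSpace H) :
    op (Complex.I : ℍ[ℝ]) • op unitJ • toReal x = -(op unitJ • op (Complex.I : ℍ[ℝ]) • toReal x) := by
  rw [smul_smul, smul_smul, ← op_mul, ← op_mul, coe_mul_unitJ, Complex.conj_I]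
  rw [show ((-Complex.I : ℂ) : ℍ[ℝ]) = -(Complex.I : ℍ[ℝ]) by ext <;> simp, mul_neg, op_neg,
    neg_smul, neg_neg]

variable {T} [CompleteSpace H]

-- Continuity is inherited from the product of the complex resolvents at `z` and `z̄`.
include hm in
lemma continuousOn_inverse_Delta (x : H) :
    ContinuousOn (fun z => Ring.inverse (Delta (slicePt m z) T) x)
      (spectrum ℂ (toSlice T))ᶜ := by
  let x' : SliceSpace H := x
  have h1 : ContinuousOn (fun z => resolvent (toSlice T) (conj z)) (spectrum ℂ (toSlice T))ᶜ :=
    continuousOn_resolvent.comp Complex.continuous_conj.continuousOn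
      fun z hz => conj_notMem_spectrum hz
  have h2 : ContinuousOn (fun z => toReal ((resolvent (toSlice T) (conj z) *
      resolvent (toSlice T) z) x')) (spectrum ℂ (toSlice T))ᶜ :=
    toReal.continuous.comp_continuousOn
      ((h1.mul continuousOn_resolvent).clm_apply continuousOn_const)
  exact h2.congr fun z hz => congrArg (fun S => toReal (S x')) (toSlice_inverse_Delta hm hz)

include hm in
lemma continuousOn_resolventIm (x : H) :
    ContinuousOn (fun z => resolventIm T m z x) (spectrum ℂ (toSlice T))ᶜ :=
  Complex.continuous_im.continuousOn.smul (continuousOn_inverse_Delta hm x)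

include hm in
lemma continuousOn_resolventRe (x : H) :
    ContinuousOn (fun z => resolventRe T m z x) (spectrum ℂ (toSlice T))ᶜ :=
  (T.continuous.comp_continuousOn (continuousOn_inverse_Delta hm x)).sub
    (Complex.continuous_re.continuousOn.smul (continuousOn_inverse_Delta hm x))

variable (T m) in
/-- The real part of the integrand of the Riesz integral. -/
noncomputable def rieszRe (Γ : Contour) (x : H) (k : Fin Γ.card) (t : ℝ) : H :=
  (deriv (Γ.arc k) t).re • resolventRe T m (Γ.arc k t) x -
    (deriv (Γ.arc k) t).im • resolventIm T m (Γ.arc k t) x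

variable (T m) in
/-- The imaginary part of the integrand of the Riesz integral. -/
noncomputable def rieszIm (Γ : Contour) (x : H) (k : Fin Γ.card) (t : ℝ) : H :=
  (deriv (Γ.arc k) t).im • resolventRe T m (Γ.arc k t) x +
    (deriv (Γ.arc k) t).re • resolventIm T m (Γ.arc k t) x

variable {Γ : Contour} (hΓ : Disjoint Γ.support (spectrum ℂ (toSlice T)))

include hm hΓ in
lemma intervalIntegrable_rieszRe (x : H) (k : Fin Γ.card) :
    IntervalIntegrable (rieszRe T m Γ x k) volume 0 1 :=
  (Contour.intervalIntegrable_clm_smul Complex.reCLM k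
    ((continuousOn_resolventRe hm x).mono hΓ.subset_compl_right)).sub
  (Contour.intervalIntegrable_clm_smul Complex.imCLM k
    ((continuousOn_resolventIm hm x).mono hΓ.subset_compl_right))

include hm hΓ in
lemma intervalIntegrable_rieszIm (x : H) (k : Fin Γ.card) :
    IntervalIntegrable (rieszIm T m Γ x k) volume 0 1 :=
  (Contour.intervalIntegrable_clm_smul Complex.imCLM k
    ((continuousOn_resolventRe hm x).mono hΓ.subset_compl_right)).add
  (Contour.intervalIntegrable_clm_smul Complex.reCLM k
    ((continuousOn_resolventIm hm x).mono hΓ.subset_compl_right))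

variable (T m Γ) in
/-- The real part of the Riesz integral, up to a factor. -/
noncomputable def rieszReIntegral (x : H) : H := ∑ k, ∫ t in (0 : ℝ)..1, rieszRe T m Γ x k t

variable (T m Γ) in
/-- The imaginary part of the Riesz integral, up to a factor. -/
noncomputable def rieszImIntegral (x : H) : H := ∑ k, ∫ t in (0 : ℝ)..1, rieszIm T m Γ x k t

include hm hΓ in
lemma map_rieszReIntegral (L : H →L[ℝ] H) (x : H) :
    ∑ k, ∫ t in (0 : ℝ)..1, L (rieszRe T m Γ x k t) = L (rieszReIntegral T m Γ x) := by
  rw [rieszReIntegral, map_sum]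
  exact Finset.sum_congr rfl fun k _ =>
    L.intervalIntegral_comp_comm (intervalIntegrable_rieszRe hm hΓ x k)

include hm hΓ in
lemma map_rieszImIntegral (L : H →L[ℝ] H) (x : H) :
    ∑ k, ∫ t in (0 : ℝ)..1, L (rieszIm T m Γ x k t) = L (rieszImIntegral T m Γ x) := by
  rw [rieszImIntegral, map_sum]
  exact Finset.sum_congr rfl fun k _ =>
    L.intervalIntegral_comp_comm (intervalIntegrable_rieszIm hm hΓ x k)

include hm hΓ in
lemma rieszReIntegral_op_smul (q : ℍ[ℝ]) (x : H) :
    rieszReIntegral T m Γ (op q • x) = op q • rieszReIntegral T m Γ x := by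
  rw [← rightMulCLM_apply, ← rightMulCLM_apply, ← map_rieszReIntegral hm hΓ]
  simp only [rieszReIntegral, rieszRe, rightMulCLM_apply, resolventRe_op_smul,
    resolventIm_op_smul, smul_sub, op_smul_real_smul]

include hm hΓ in
lemma rieszImIntegral_op_smul (q : ℍ[ℝ]) (x : H) :
    rieszImIntegral T m Γ (op q • x) = op q • rieszImIntegral T m Γ x := by
  rw [← rightMulCLM_apply, ← rightMulCLM_apply, ← map_rieszImIntegral hm hΓ]
  simp only [rieszImIntegral, rieszIm, rightMulCLM_apply, resolventRe_op_smul,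
    resolventIm_op_smul, smul_add, op_smul_real_smul]

include hm hΓ in
lemma toReal_integral_resolvent (x : SliceSpace H) :
    toReal (Γ.integral (resolvent (toSlice T)) x) = -rieszReIntegral T m Γ (toReal x) -
      op (Complex.I : ℍ[ℝ]) • rieszImIntegral T m Γ (toReal x) := by
  have hR : ContinuousOn (resolvent (toSlice T)) Γ.support :=
    continuousOn_resolvent.mono hΓ.subset_compl_right
  have h1 := Contour.map_integral (ContinuousLinearMap.apply ℂ (SliceSpace H) x) hR
  simp only [ContinuousLinearMap.apply_apply] at h1
  have h2 : ContinuousOn (fun z => resolvent (toSlice T) z x) Γ.support :=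
    hR.clm_apply continuousOn_const
  rw [h1, Contour.integral, map_sum, ← rightMulCLM_apply, ← map_rieszImIntegral hm hΓ,
    rieszReIntegral, ← Finset.sum_neg_distrib, ← Finset.sum_sub_distrib]
  refine Finset.sum_congr rfl fun k _ => ?_
  rw [← toReal.intervalIntegral_comp_comm (Contour.intervalIntegrable k h2),
    ← intervalIntegral.integral_neg, ← intervalIntegral.integral_sub
      (f := fun t => -rieszRe T m Γ (toReal x) k t) (intervalIntegrable_rieszRe hm hΓ _ k).neg]
  · refine intervalIntegral.integral_congr fun t ht => ?_
    rw [uIcc_of_le zero_le_one] at ht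
    have hz := hΓ.notMem_of_mem_left (Γ.arc_mem_support k ht)
    have hI : ∀ y : H, op (Complex.I : ℍ[ℝ]) • op (Complex.I : ℍ[ℝ]) • y = -y := fun y => by
      rw [smul_smul, ← op_mul, ← Quaternion.coeComplex_mul, Complex.I_mul_I]
      rw [show ((-1 : ℂ) : ℍ[ℝ]) = -1 by ext <;> simp, op_neg, op_one, neg_smul, one_smul]
    simp only [toReal_smul, toReal_resolvent T hm hz, rieszRe, rieszIm, rightMulCLM_apply,
      smul_sub, smul_add, smul_neg, op_smul_real_smul, hI]
    generalize op (Complex.I : ℍ[ℝ]) • resolventRe T m (Γ.arc k t) (toReal x) = y₁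
    generalize op (Complex.I : ℍ[ℝ]) • resolventIm T m (Γ.arc k t) (toReal x) = y₂
    module
  · exact ⟨(rightMulCLM _).integrable_comp (intervalIntegrable_rieszIm hm hΓ _ k).1,
      (rightMulCLM _).integrable_comp (intervalIntegrable_rieszIm hm hΓ _ k).2⟩

include hm hΓ in
lemma riesz_eq {P : H →L[ℍ[ℝ]ᵐᵒᵖ] H} (hP : toSlice P = Γ.riesz (toSlice T)) (x : H) :
    (2 * Real.pi) • op (Complex.I : ℍ[ℝ]) • P x =
      -rieszReIntegral T m Γ x - op (Complex.I : ℍ[ℝ]) • rieszImIntegral T m Γ x := by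
  have h1 : Γ.integral (resolvent (toSlice T)) = (2 * Real.pi * Complex.I) • toSlice P := by
    rw [hP, Contour.riesz, smul_inv_smul₀ Complex.two_pi_I_ne_zero]
  have h2 : (2 * Real.pi * Complex.I).re = 0 := by simp
  have h3 : (2 * Real.pi * Complex.I).im = 2 * Real.pi := by simp
  have h4 : ∀ y : SliceSpace H, (2 * Real.pi) • op (Complex.I : ℍ[ℝ]) • P (toReal y) =
      -rieszReIntegral T m Γ (toReal y) -
        op (Complex.I : ℍ[ℝ]) • rieszImIntegral T m Γ (toReal y) := fun y => by
    rw [← toReal_integral_resolvent hm hΓ, h1, smul_apply, toReal_smul, toReal_toSlice, h2, h3,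
      zero_smul, zero_add]
  exact h4 x

include hm hΓ in
/-- If the Riesz integral over a contour is `ℍ`-linear, its real part vanishes. -/
lemma rieszReIntegral_eq_zero {P : H →L[ℍ[ℝ]ᵐᵒᵖ] H}
    (hP : toSlice P = Γ.riesz (toSlice T)) (x : H) : rieszReIntegral T m Γ x = 0 := by
  have h1 := riesz_eq hm hΓ hP x
  -- Moving `j` to the outside changes the sign of the terms containing `i` but not of the real
  -- part, so the real part equals its own negative.
  have h2 := riesz_eq hm hΓ hP (op unitJ • x)
  have hij : ∀ y : H, op (Complex.I : ℍ[ℝ]) • op unitJ • y =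
    -(op unitJ • op (Complex.I : ℍ[ℝ]) • y) := op_I_smul_op_unitJ_smul
  rw [map_smul, hij, rieszReIntegral_op_smul hm hΓ, rieszImIntegral_op_smul hm hΓ, hij, smul_neg,
    ← op_smul_real_smul, h1, smul_sub, smul_neg] at h2
  have h3 : (2 : ℝ) • op unitJ • rieszReIntegral T m Γ x = 0 := by
    rw [two_smul]
    generalize op unitJ • rieszReIntegral T m Γ x = a at h2 ⊢
    generalize op unitJ • op (Complex.I : ℍ[ℝ]) • rieszImIntegral T m Γ x = b at h2
    have h4 : a + a = -(-a - b) - (-a - -b) := by abel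
    rw [h4, h2, sub_self]
  rw [smul_eq_zero_iff_right two_ne_zero, ← norm_eq_zero, norm_op_smul, norm_unitJ, one_mul,
    norm_eq_zero] at h3
  exact h3

/-- With `ds = a + mb` one has `ds_m = b - ma`, and `S_R⁻¹(s, T)` is `-R - mI`, where `R` and `I`
are `resolventRe` and `resolventIm`. Since `m² = -1`, the product is `m(aR - bI) - (bR + aI)`. -/
lemma integrand_eq {N : Set H} (hN : IsHilbertBasis N) (hm : m ∈ imaginaryUnits)
    (k : Fin Γ.card) (t : ℝ) (x : H) :
    leftMul N (-(slicePt m (deriv (Γ.arc k) t) * m))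
      (rightResolvent N (slicePt m (Γ.arc k t)) T x) =
      hN.leftMulCLM m (rieszRe T m Γ x k t) - rieszIm T m Γ x k t := by
  have hmm : ∀ y : H, hN.leftMulCLM m (hN.leftMulCLM m y) = -y := fun y => by
    rw [IsHilbertBasis.leftMulCLM_apply, IsHilbertBasis.leftMulCLM_apply, hN.leftMul_leftMul,
      imaginaryUnit_mul_self hm, ← Quaternion.coe_one, ← Quaternion.coe_neg, hN.leftMul_coe,
      neg_one_smul]
  have hL : ∀ (a b : ℝ) (y : H), leftMul N ((a : ℍ[ℝ]) + m * (b : ℍ[ℝ])) y =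
      a • y + b • hN.leftMulCLM m y := fun a b y => by
    rw [hN.add_leftMul, ← hN.leftMul_leftMul, hN.leftMul_coe, hN.leftMul_coe, hN.leftMul_smul,
      IsHilbertBasis.leftMulCLM_apply]
  have h1 : -(slicePt m (deriv (Γ.arc k) t) * m) = ((deriv (Γ.arc k) t).im : ℍ[ℝ]) +
      m * ((-(deriv (Γ.arc k) t).re : ℝ) : ℍ[ℝ]) := by
    rw [slicePt, add_mul, mul_assoc, (Quaternion.coe_commute _ m).eq,
      (Quaternion.coe_commute _ m).eq, ← mul_assoc, imaginaryUnit_mul_self hm, Quaternion.coe_neg,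
      mul_neg, neg_one_mul]
    abel
  have h2 : star (slicePt m (Γ.arc k t)) = ((Γ.arc k t).re : ℍ[ℝ]) +
      m * ((-(Γ.arc k t).im : ℝ) : ℍ[ℝ]) := by
    rw [star_slicePt hm, Quaternion.coe_neg, mul_neg, sub_eq_add_neg]
  rw [h1, hL, rightResolvent, h2, hL]
  simp only [rieszRe, rieszIm, resolventRe, resolventIm, map_sub, map_add, map_neg, map_smul, hmm]
  module

include hm hΓ in
/-- The Riesz integral in the sense of the left multiplication agrees with the complex one. -/
lemma rieszIntegral_eq {P : H →L[ℍ[ℝ]ᵐᵒᵖ] H} (hP : toSlice P = Γ.riesz (toSlice T)) {N : Set H}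
    (hN : IsHilbertBasis N) (x : H) : rieszIntegral T m N Γ x = P x := by
  have h1 : ∑ k, ∫ t in (0 : ℝ)..1, leftMul N (-(slicePt m (deriv (Γ.arc k) t) * m))
      (rightResolvent N (slicePt m (Γ.arc k t)) T x) =
      hN.leftMulCLM m (rieszReIntegral T m Γ x) - rieszImIntegral T m Γ x := by
    rw [← map_rieszReIntegral hm hΓ, rieszImIntegral, ← Finset.sum_sub_distrib]
    refine Finset.sum_congr rfl fun k _ => ?_
    rw [← intervalIntegral.integral_sub _ (intervalIntegrable_rieszIm hm hΓ x k)]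
    · simp only [integrand_eq hN hm]
    · exact ⟨(hN.leftMulCLM m).integrable_comp (intervalIntegrable_rieszRe hm hΓ x k).1,
        (hN.leftMulCLM m).integrable_comp (intervalIntegrable_rieszRe hm hΓ x k).2⟩
  have h2 := riesz_eq hm hΓ hP x
  rw [rieszReIntegral_eq_zero hm hΓ hP, neg_zero, zero_sub, ← op_smul_real_smul, ← smul_neg] at h2
  have h3 : (2 * Real.pi) • P x = -rieszImIntegral T m Γ x := by
    rw [← sub_eq_zero, ← smul_sub, ← norm_eq_zero, norm_op_smul, norm_coeComplex, Complex.norm_I,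
      one_mul, norm_eq_zero] at h2
    · exact sub_eq_zero.1 h2
  rw [rieszIntegral, h1, rieszReIntegral_eq_zero hm hΓ hP, map_zero, zero_sub, ← h3,
    inv_smul_smul₀ (by positivity)]

end Riesz

end Quat

/-! ### Transfer of the complex Riesz projection to the quaternionic operator. -/

theorem mainTheorem4 {H : Type*} [NormedAddCommGroup H] [NormedSpace ℝ H] [Module ℍ[ℝ]ᵐᵒᵖ H]
    [IsScalarTower ℝ ℍ[ℝ]ᵐᵒᵖ H] [QuaternionicInnerProductSpace H] [CompleteSpace H]
    (T : H →L[ℍ[ℝ]ᵐᵒᵖ] H) (σ τ : Set ℍ[ℝ])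
    (hσ_sym : Quat.IsAxiallySymmetric σ) (hτ_sym : Quat.IsAxiallySymmetric τ)
    (hσ_closed : IsClosed σ) (hτ_closed : IsClosed τ)
    (hσ_ne : σ.Nonempty) (hτ_ne : τ.Nonempty) (h_disj : Disjoint σ τ)
    (h_union : Quat.sphericalSpectrum T = σ ∪ τ) :
    Quat.IsStronglyReducible T ∧
    ∃ P : H →L[ℍ[ℝ]ᵐᵒᵖ] H, Quat.IsRieszProjection T σ τ P ∧
      P * P = P ∧ P ≠ 0 ∧ P ≠ 1 ∧ T * P = P * T := by
  suffices h : ∃ P : H →L[ℍ[ℝ]ᵐᵒᵖ] H, Quat.IsRieszProjection T σ τ P ∧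
      P * P = P ∧ P ≠ 0 ∧ P ≠ 1 ∧ T * P = P * T by
    obtain ⟨P, hP, h1⟩ := h
    exact ⟨⟨P, h1⟩, P, hP, h1⟩
  obtain ⟨S₁, hS₁, rfl⟩ := hσ_sym
  obtain ⟨S₂, hS₂, rfl⟩ := hτ_sym
  obtain ⟨n, hn⟩ := Quat.exists_imaginaryUnit
  have hc₁ := Quat.isClosed_of_circularization hS₁ hσ_closed
  have hc₂ := Quat.isClosed_of_circularization hS₂ hτ_closed
  have hne₁ : S₁.Nonempty := by
    obtain ⟨_, z, hz, -⟩ := hσ_ne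
    exact ⟨z, hz⟩
  have hne₂ : S₂.Nonempty := by
    obtain ⟨_, z, hz, -⟩ := hτ_ne
    exact ⟨z, hz⟩
  have hd : Disjoint S₁ S₂ := Set.disjoint_left.2 fun z h1 h2 => Set.disjoint_left.1 h_disj
    ((Quat.slicePt_mem_circularization hS₁ hn).2 h1)
    ((Quat.slicePt_mem_circularization hS₂ hn).2 h2)
  have hS : spectrum ℂ (Quat.SliceSpace.toSlice T) = S₁ ∪ S₂ := Set.ext fun z => by
    rw [Quat.mem_spectrum_toSlice hn, h_union, Set.mem_union, Set.mem_union,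
      Quat.slicePt_mem_circularization hS₁ hn, Quat.slicePt_mem_circularization hS₂ hn]
  have hK₁ : IsCompact S₁ :=
    (spectrum.isCompact (Quat.SliceSpace.toSlice T)).of_isClosed_subset hc₁
      (hS ▸ Set.subset_union_left)
  obtain ⟨Γ₀, hΓ₀, hw₁, hw₂⟩ := Quat.exists_contour hK₁ hc₂ hd
  have hsplit := Quat.Contour.isSpectralSplitting_riesz hS (hS.symm ▸ hΓ₀) hw₁ hw₂
  -- Conjugation by `j` produces another splitting for the same pair `S₁`, `S₂`, so uniqueness shows
  -- that the Riesz integral is fixed and descends to an `ℍ`-linear `P`.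
  obtain ⟨P, hP⟩ := Quat.SliceSpace.exists_toSlice_eq
    ((hsplit.map_conj Quat.SliceSpace.conjJ Quat.SliceSpace.continuous_conjJ
      Quat.SliceSpace.conjJ_smul (Quat.SliceSpace.conjJ_toSlice T) hS₁ hS₂).unique hsplit
      hS hc₁ hc₂ hd)
  rw [← hP] at hsplit
  refine ⟨P, fun m hm => ⟨⟨Γ₀, (Quat.Contour.separates_circularization_iff hm hS₁ hS₂).2
    ⟨hΓ₀, hw₁, hw₂⟩⟩, fun N hN Γ hΓ x => ?_⟩, ?_, ?_, ?_, ?_⟩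
  · rw [Quat.Contour.separates_circularization_iff hm hS₁ hS₂] at hΓ
    obtain ⟨hΓ, h1, h2⟩ := hΓ
    rw [← hS] at hΓ
    refine (Quat.rieszIntegral_eq hm hΓ ?_ hN x).symm
    -- The Riesz integral over any other separating contour is again a splitting, hence the same
    -- operator.
    exact hsplit.unique (Quat.Contour.isSpectralSplitting_riesz hS hΓ h1 h2) hS hc₁ hc₂ hd
  · exact Quat.SliceSpace.toSlice_injective
      (by rw [map_mul]; exact hsplit.mul_self hS hc₁ hc₂ hd)
  · exact fun h => hsplit.ne_zero hS hne₁ (by rw [h, map_zero])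
  · exact fun h => hsplit.ne_one hS hne₂ (by rw [h, map_one])
  · exact Quat.SliceSpace.toSlice_injective
      (by rw [map_mul, map_mul]; exact hsplit.commute.eq)
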